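/- Let $d,d'\ge 0$ be integers, $\alpha\in(1/3,1/2)$, and $M,K,L\ge 0$. All vector norms $\|\cdot\|_\infty$ are maximum norms, $\Delta_n=2^{-n}$ and $t^n_k=k2^{-n}$. Let $\mu:\mathbb R^d\to\mathbb R^d$ be differentiable and $\sigma:\mathbb R^d\to\mathbb R^{d\times d'}$ three times differentiable, such that all components of $\mu$ and $\sigma$, all first partial derivatives of $\mu$, and all partial derivatives of $\sigma$ of order $1,2,3$ are bounded by $M$ in absolute value. Let $Z:[0,1]\to\mathbb R^{d'}$ and $A_{i,j}(s,t)$ ($1\le i,j\le d'$, $0\le s<t\le1$) satisfy $$A_{i,j}(r,t)=A_{i,j}(r,s)+A_{i,j}(s,t)+(Z_i(s)-Z_i(r))(Z_j(t)-Z_j(s)),\qquad 0\le r<s<t\le 1,$$ $$\|Z\|_\alpha=\sup_{0\le s<t\le1}\frac{\|Z(t)-Z(s)\|_\infty}{|t-s|^\alpha}\le K,\qquad \|A\|_{2\alpha}=\sup_{0\le s<t\le1}\max_{i,j}\frac{|A_{i,j}(s,t)|}{|t-s|^{2\alpha}}\le L$$ (for instance a path of Brownian motion with its It\^o iterated integrals).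 Put $$\Phi_i(s,t,x)=\mu_i(x)(t-s)+\sum_{j}\sigma_{i,j}(x)(Z_j(t)-Z_j(s))+\sum_{j,m=1}^{d'}\sum_{l=1}^{d}\partial_l\sigma_{i,j}(x)\,\sigma_{l,m}(x)\,A_{m,j}(s,t).$$ Let $X:[0,1]\to\mathbb R^d$ be a solution of $dX=\mu(X)\,dt+\sigma(X)\,dZ$, $X(0)=x(0)$, driven by $(Z,A)$, that is, $X(0)=x(0)$ and $|X_i(t)-X_i(s)-\Phi_i(s,t,X(s))|=o(t-s)$ for all $i$, uniformly in $0\le s<t\le1$. Let $X^n$ be the Milstein-type scheme with the true areas: $X^n(0)=x(0)$, $$X^n(t^n_{k+1})=X^n(t^n_k)+\Phi(t^n_k,t^n_{k+1},X^n(t^n_k)),\qquad 0\le k<2^n,$$ and $X^n(t)=X^n(\max\{t^n_k: t^n_k\le t\})$ for $t\in[0,1]$. Then there is $n_0$, depending only on $d,d',\alpha,M,K,L$, such that for all $n\ge n_0$ $$\sup_{t\in[0,1]}\|X^n(t)-X(t)\|_\infty\le G_1\,\Delta_n^{3\alpha-1},\qquad G_1=(1+B)\,C_3,$$ where $G_1$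 is given explicitly in terms of $d,d',\alpha,M,K,L$ as follows (one may take $K=\|Z\|_\alpha$, $L=\|A\|_{2\alpha}$). Put $\rho=2/(1-2^{1-3\alpha})$ and $$\kappa(c_1,c_2)=dMc_1+d'K\big(d^2Mc_1^2+dM(c_2+M)\big)+2d^2d'^2M^2L\,c_1 .$$ Further $$c_1=1+M+d'MK+dd'^2M^2L,\quad c_2=1+dd'^2M^2L,\quad c_3=\rho\,\kappa(c_1,c_2),\quad \delta=(2+c_3)^{-1/\alpha},$$ $$C_1=\tfrac2\delta c_1,\qquad C_2=\tfrac2\delta\big(c_2+dMC_1+dd'MK\,C_1\big),\qquad C_3=\rho\,\kappa(C_1,C_2),$$ $$b_1=1+dM+dd'MK+2d^2d'^2M^2L,\qquad b_2=1+dM+2d^2d'^2M^2L,$$ $$b_3=\rho\Big\{d'K\big(d^3MC_1^2+d^2MC_1b_1+d^2M(M+C_2)+dMb_2\big)+d'^2L\big(4d^3M^2C_1+2d^2M^2b_1\big)\Big\},$$ $$\delta'=(2+2b_1+b_3)^{-1/\alpha},\qquad B=(2+2b_1+b_3)\,\big(1+2^{2/\delta'}\big).$$ -/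

import Mathlib

namespace RoughMilstein

noncomputable section

open scoped ENNReal

/-- `∂_l σ_{i,j}(x)`. -/
def partialDeriv {d d' : ℕ} (σ : (Fin d → ℝ) → Fin d → Fin d' → ℝ)
    (l i : Fin d) (j : Fin d') (x : Fin d → ℝ) : ℝ :=
  fderiv ℝ σ x (Pi.single l 1) i j

/-- `μ` is differentiable and `σ` is three times differentiable; the components of `μ` and `σ`, the
first partial derivatives of `μ`, and all partial derivatives of `σ` up to order three are bounded
by `M` on the whole space. -/
structure CoeffBounds {d d' : ℕ} (μ : (Fin d → ℝ) → Fin d → ℝ)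
    (σ : (Fin d → ℝ) → Fin d → Fin d' → ℝ) (M : ℝ) : Prop where
  differentiable_drift : Differentiable ℝ μ
  drift_le : ∀ x i, |μ x i| ≤ M
  fderiv_drift_le : ∀ x l i, |fderiv ℝ μ x (Pi.single l 1) i| ≤ M
  differentiable_diffusion : ∀ k < 3, Differentiable ℝ (iteratedFDeriv ℝ k σ)
  diffusion_le : ∀ k ≤ 3, ∀ (x : Fin d → ℝ) (l : Fin k → Fin d) (i : Fin d) (j : Fin d'),
    |iteratedFDeriv ℝ k σ x (fun a => Pi.single (l a) 1) i j| ≤ M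

/-- `‖Z‖_α = sup_{0 ≤ s < t ≤ 1} ‖Z(t) - Z(s)‖_∞ / |t - s|^α`, possibly infinite. -/
def pathNorm {d' : ℕ} (α : ℝ) (Z : ℝ → Fin d' → ℝ) : ℝ≥0∞ :=
  ⨆ (s : ℝ) (t : ℝ) (_ : 0 ≤ s) (_ : s < t) (_ : t ≤ 1),
    ENNReal.ofReal (‖Z t - Z s‖ / (t - s) ^ α)

/-- `‖A‖_{2α} = sup_{0 ≤ s < t ≤ 1} max_{i,j} |A_{i,j}(s,t)| / |t - s|^{2α}`, possibly infinite. -/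
def areaNorm {d' : ℕ} (α : ℝ) (A : ℝ → ℝ → Fin d' → Fin d' → ℝ) : ℝ≥0∞ :=
  ⨆ (s : ℝ) (t : ℝ) (_ : 0 ≤ s) (_ : s < t) (_ : t ≤ 1) (i : Fin d') (j : Fin d'),
    ENNReal.ofReal (|A s t i j| / (t - s) ^ (2 * α))

/-- The algebraic (Chen) relation satisfied by `A_{i,j}(s,t) = ∫_s^t (Z_i(u) - Z_i(s)) dZ_j(u)`. -/
def IsArea {d' : ℕ} (Z : ℝ → Fin d' → ℝ) (A : ℝ → ℝ → Fin d' → Fin d' → ℝ) : Prop :=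
  ∀ r s t : ℝ, 0 ≤ r → r < s → s < t → t ≤ 1 → ∀ i j,
    A r t i j = A r s i j + A s t i j + (Z s i - Z r i) * (Z t j - Z s j)

/-- The second-order increment over `[s, t]` started from the state `x`:
`μ_i(x)(t-s) + ∑_j σ_{i,j}(x)(Z_j(t)-Z_j(s)) + ∑_{j,l,m} ∂_l σ_{i,j}(x) σ_{l,m}(x) A_{m,j}(s,t)`. -/
def increment {d d' : ℕ} (μ : (Fin d → ℝ) → Fin d → ℝ)
    (σ : (Fin d → ℝ) → Fin d → Fin d' → ℝ) (Z : ℝ → Fin d' → ℝ)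
    (A : ℝ → ℝ → Fin d' → Fin d' → ℝ) (s t : ℝ) (x : Fin d → ℝ) : Fin d → ℝ := fun i =>
  μ x i * (t - s) + ∑ j, σ x i j * (Z t j - Z s j)
    + ∑ j, ∑ l, ∑ m, partialDeriv σ l i j x * σ x l m * A s t m j

/-- `X` solves `dX = μ(X) dt + σ(X) dZ`, `X(0) = x₀`, on `[0, 1]`, driven by `(Z, A)`: the
second-order expansion holds with a remainder `o(t - s)`, uniformly in `0 ≤ s < t ≤ 1`. -/
structure IsSolution {d d' : ℕ} (μ : (Fin d → ℝ) → Fin d → ℝ)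
    (σ : (Fin d → ℝ) → Fin d → Fin d' → ℝ) (Z : ℝ → Fin d' → ℝ)
    (A : ℝ → ℝ → Fin d' → Fin d' → ℝ) (x₀ : Fin d → ℝ) (X : ℝ → Fin d → ℝ) : Prop where
  initial : X 0 = x₀
  area : IsArea Z A
  expansion : ∀ ε > 0, ∃ δ > 0, ∀ s t : ℝ, 0 ≤ s → s < t → t ≤ 1 → t - s < δ → ∀ i,
    |X t i - X s i - increment μ σ Z A s t (X s) i| ≤ ε * (t - s)

/-- The mesh `Δ_n = 2^{-n}`. -/
def mesh (n : ℕ) : ℝ := 1 / 2 ^ n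

/-- The dyadic points `t_k^n = k / 2^n`. -/
def gridPoint (n k : ℕ) : ℝ := k / 2 ^ n

/-- The values `X^n(t_k^n)` of the scheme at the dyadic points. -/
def schemeGrid {d d' : ℕ} (μ : (Fin d → ℝ) → Fin d → ℝ)
    (σ : (Fin d → ℝ) → Fin d → Fin d' → ℝ) (Z : ℝ → Fin d' → ℝ)
    (A : ℝ → ℝ → Fin d' → Fin d' → ℝ) (x₀ : Fin d → ℝ) (n : ℕ) : ℕ → Fin d → ℝ
  | 0 => x₀
  | k + 1 => schemeGrid μ σ Z A x₀ n k
      + increment μ σ Z A (gridPoint n k) (gridPoint n (k + 1)) (schemeGrid μ σ Z A x₀ n k)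

/-- `X^n(t) = X^n(⌊t⌋)`, where `⌊t⌋` is the largest dyadic point of order `n` not above `t`. -/
def scheme {d d' : ℕ} (μ : (Fin d → ℝ) → Fin d → ℝ)
    (σ : (Fin d → ℝ) → Fin d → Fin d' → ℝ) (Z : ℝ → Fin d' → ℝ)
    (A : ℝ → ℝ → Fin d' → Fin d' → ℝ) (x₀ : Fin d → ℝ) (n : ℕ) (t : ℝ) : Fin d → ℝ :=
  schemeGrid μ σ Z A x₀ n ⌊2 ^ n * t⌋₊

/-! The explicit constants. Throughout `K` and `L` stand for (bounds on) `‖Z‖_α` and `‖A‖_{2α}`. -/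

/-- The constant of the three-point recursion for the second-order remainder of the scheme, given
constants `c₁`, `c₂` for the increments and for the first-order remainder. -/
def kappa (d d' : ℕ) (M K L c₁ c₂ : ℝ) : ℝ :=
  d * M * c₁ + d' * K * (d ^ 2 * M * c₁ ^ 2 + d * M * (c₂ + M)) + 2 * d ^ 2 * d' ^ 2 * M ^ 2 * L * c₁

/-- `C₁(δ)` -/
def locC1 (d d' : ℕ) (M K L : ℝ) : ℝ := 1 + M + d' * M * K + d * d' ^ 2 * M ^ 2 * L

/-- `C₂(δ)` -/
def locC2 (d d' : ℕ) (M L : ℝ) : ℝ := 1 + d * d' ^ 2 * M ^ 2 * L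

/-- `C₃(δ)` -/
def locC3 (d d' : ℕ) (α M K L : ℝ) : ℝ :=
  2 / (1 - 2 ^ (1 - 3 * α)) * kappa d d' M K L (locC1 d d' M K L) (locC2 d d' M L)

/-- `δ` -/
def delta (d d' : ℕ) (α M K L : ℝ) : ℝ := (2 + locC3 d d' α M K L) ^ (-(1 / α))

/-- `C₁` -/
def constC1 (d d' : ℕ) (α M K L : ℝ) : ℝ := 2 / delta d d' α M K L * locC1 d d' M K L

/-- `C₂` -/
def constC2 (d d' : ℕ) (α M K L : ℝ) : ℝ :=
  2 / delta d d' α M K L *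
    (locC2 d d' M L + d * M * constC1 d d' α M K L + d * d' * M * K * constC1 d d' α M K L)

/-- `C₃` -/
def constC3 (d d' : ℕ) (α M K L : ℝ) : ℝ :=
  2 / (1 - 2 ^ (1 - 3 * α)) *
    kappa d d' M K L (constC1 d d' α M K L) (constC2 d d' α M K L)

/-- `B₁(δ')` -/
def locB1 (d d' : ℕ) (M K L : ℝ) : ℝ :=
  1 + d * M + d * d' * M * K + 2 * d ^ 2 * d' ^ 2 * M ^ 2 * L

/-- `B₂(δ')` -/
def locB2 (d d' : ℕ) (M L : ℝ) : ℝ := 1 + d * M + 2 * d ^ 2 * d' ^ 2 * M ^ 2 * L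

/-- `B₃(δ')` -/
def locB3 (d d' : ℕ) (α M K L : ℝ) : ℝ :=
  2 / (1 - 2 ^ (1 - 3 * α)) *
    (d' * K * (d ^ 3 * M * constC1 d d' α M K L ^ 2
        + d ^ 2 * M * constC1 d d' α M K L * locB1 d d' M K L
        + d ^ 2 * M * (M + constC2 d d' α M K L) + d * M * locB2 d d' M L)
      + d' ^ 2 * L * (4 * d ^ 3 * M ^ 2 * constC1 d d' α M K L
        + 2 * d ^ 2 * M ^ 2 * locB1 d d' M K L))

/-- `δ'` -/
def delta' (d d' : ℕ) (α M K L : ℝ) : ℝ :=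
  (2 + 2 * locB1 d d' M K L + locB3 d d' α M K L) ^ (-(1 / α))

/-- `B` -/
def constB (d d' : ℕ) (α M K L : ℝ) : ℝ :=
  (2 + 2 * locB1 d d' M K L + locB3 d d' α M K L) * (1 + 2 ^ (2 / delta' d d' α M K L))

/-- `G₁ = (1 + B) C₃` -/
def constG1 (d d' : ℕ) (α M K L : ℝ) : ℝ :=
  (1 + constB d d' α M K L) * constC3 d d' α M K L

end

end RoughMilstein

/-!
Over `r < s < t` the second-order increments fail to be additive by `O((t - r) ^ (3 * α))`. Since
`3 * α > 1`, bisecting an interval sums a geometric series of such defects, so the remainder of a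
path which follows the increments on a fine grid is `O((t - s) ^ (3 * α))` on all scales. The
constant in the defect involves first-order bounds on the path, which in turn follow from the
remainder estimate: this circle closes on intervals of a length `δ` fixed in advance, and at most
`2 / δ` of them cover `[0, 1]`. The same argument for the difference of two trajectories of the
scheme shows that the scheme depends Lipschitz continuously on its initial state. Restarting the
scheme from the solution at every grid point, the errors of the `2 ^ n` steps, each
`O(mesh n ^ (3 * α))`, therefore add up to `O(mesh n ^ (3 * α - 1))`.
-/

namespace RoughMilstein

universe u

section Calculus

variable {E F : Type u} [NormedAddCommGroup E] [NormedSpace ℝ E] [NormedAddCommGroup F]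
  [NormedSpace ℝ F]

/-- `f` is `n` times differentiable and its derivative of order `k ≤ n` is bounded by `r ^ k * M`.
For a function on `ℝ^d` with the maximum norm whose partial derivatives are bounded by `M`, one may
take `r = d`. -/
structure BoundedDerivs (r M : ℝ) (n : ℕ) (f : E → F) : Prop where
  differentiable_iteratedFDeriv : ∀ k < n, Differentiable ℝ (iteratedFDeriv ℝ k f)
  norm_iteratedFDeriv_le : ∀ k ≤ n, ∀ x, ‖iteratedFDeriv ℝ k f x‖ ≤ r ^ k * M

theorem differentiable_iteratedFDeriv_zero_iff {f : E → F} :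
    Differentiable ℝ (iteratedFDeriv ℝ 0 f) ↔ Differentiable ℝ f := by
  rw [iteratedFDeriv_zero_eq_comp, LinearIsometryEquiv.comp_differentiable_iff]

theorem differentiable_iteratedFDeriv_succ_iff {f : E → F} {k : ℕ} :
    Differentiable ℝ (iteratedFDeriv ℝ (k + 1) f) ↔
      Differentiable ℝ (iteratedFDeriv ℝ k (fderiv ℝ f)) := by
  have hcurry : iteratedFDeriv ℝ (k + 1) f = (continuousMultilinearCurryRightEquiv' ℝ k E F).symm ∘
      iteratedFDeriv ℝ k (fderiv ℝ f) := funext fun _ => iteratedFDeriv_succ_eq_comp_right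
  rw [hcurry]
  exact LinearIsometryEquiv.comp_differentiable_iff (𝕜 := ℝ) (E := E [×k]→L[ℝ] E →L[ℝ] F)
    (F := E [×k.succ]→L[ℝ] F) _

theorem norm_lineSegment_sub_le {x u x' u' : E} {S θ : ℝ} (hx : ‖x - x'‖ ≤ S)
    (hxu : ‖x + u - (x' + u')‖ ≤ S) (hθ₀ : 0 ≤ θ) (hθ₁ : θ ≤ 1) :
    ‖x + θ • u - (x' + θ • u')‖ ≤ S := by
  have hconvex : x + θ • u - (x' + θ • u') = (1 - θ) • (x - x') + θ • (x + u - (x' + u')) := by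
    module
  rw [← mem_closedBall_zero_iff] at hx hxu ⊢
  rw [hconvex]
  exact convex_closedBall 0 S hx hxu (sub_nonneg.mpr hθ₁) hθ₀ (sub_add_cancel 1 θ)

theorem norm_sub_le_half_of_norm_deriv_le {φ φ' : ℝ → E} {Q : ℝ}
    (hφ : ∀ θ, HasDerivAt φ (φ' θ) θ) (hφ' : ∀ θ ∈ Set.Ico (0 : ℝ) 1, ‖φ' θ‖ ≤ Q * θ) :
    ‖φ 1 - φ 0‖ ≤ Q / 2 := by
  have hquadratic (θ : ℝ) : HasDerivAt (fun θ : ℝ => Q / 2 * θ ^ 2) (Q * θ) θ :=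
    ((hasDerivAt_pow 2 θ).const_mul (Q / 2)).congr_deriv (by norm_num; ring)
  have key := image_norm_le_of_norm_deriv_right_le_deriv_boundary (f := fun θ => φ θ - φ 0)
    (fun θ _ => ((hφ θ).sub_const _).continuousAt.continuousWithinAt)
    (fun θ _ => ((hφ θ).sub_const _).hasDerivWithinAt) (by simp) hquadratic hφ'
    (Set.right_mem_Icc.mpr zero_le_one)
  simpa only [one_pow, mul_one] using key

namespace BoundedDerivs

variable {r M S U V : ℝ} {n : ℕ} {f g : E → F} {x x' u u' : E}

theorem norm_le (hf : BoundedDerivs r M n f) (x : E) : ‖f x‖ ≤ M := by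
  simpa only [norm_iteratedFDeriv_zero, pow_zero, one_mul] using
    hf.norm_iteratedFDeriv_le 0 n.zero_le x

theorem zero_iff : BoundedDerivs r M 0 f ↔ ∀ x, ‖f x‖ ≤ M := by
  refine ⟨fun hf => hf.norm_le, fun hf => ⟨fun k hk => absurd hk k.not_lt_zero, fun k hk x => ?_⟩⟩
  obtain rfl := Nat.le_zero.mp hk
  simpa only [norm_iteratedFDeriv_zero, pow_zero, one_mul] using hf x

theorem succ_iff : BoundedDerivs r M (n + 1) f ↔
    (∀ x, ‖f x‖ ≤ M) ∧ Differentiable ℝ f ∧ BoundedDerivs r (r * M) n (fderiv ℝ f) := by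
  constructor
  · intro hf
    refine ⟨hf.norm_le,
      differentiable_iteratedFDeriv_zero_iff.mp (hf.differentiable_iteratedFDeriv 0 n.succ_pos),
      fun k hk => differentiable_iteratedFDeriv_succ_iff.mp
        (hf.differentiable_iteratedFDeriv (k + 1) (Nat.succ_lt_succ hk)), fun k hk x => ?_⟩
    rw [norm_iteratedFDeriv_fderiv, ← mul_assoc, ← pow_succ]
    exact hf.norm_iteratedFDeriv_le (k + 1) (Nat.succ_le_succ hk) x
  · rintro ⟨hle, hdiff, hf'⟩
    refine ⟨fun k hk => ?_, fun k hk x => ?_⟩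
    · cases k with
      | zero => exact differentiable_iteratedFDeriv_zero_iff.mpr hdiff
      | succ k =>
        exact differentiable_iteratedFDeriv_succ_iff.mpr
          (hf'.differentiable_iteratedFDeriv k (Nat.lt_of_succ_lt_succ hk))
    · cases k with
      | zero => simpa only [norm_iteratedFDeriv_zero, pow_zero, one_mul] using hle x
      | succ k =>
        rw [← norm_iteratedFDeriv_fderiv, pow_succ, mul_assoc]
        exact hf'.norm_iteratedFDeriv_le k (Nat.le_of_succ_le_succ hk) x

theorem of_le {m : ℕ} (hf : BoundedDerivs r M n f) (hmn : m ≤ n) : BoundedDerivs r M m f :=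
  ⟨fun k hk => hf.differentiable_iteratedFDeriv k (hk.trans_le hmn),
    fun k hk => hf.norm_iteratedFDeriv_le k (hk.trans hmn)⟩

theorem differentiable (hf : BoundedDerivs r M (n + 1) f) : Differentiable ℝ f :=
  (succ_iff.mp hf).2.1

protected theorem fderiv (hf : BoundedDerivs r M (n + 1) f) :
    BoundedDerivs r (r * M) n (fderiv ℝ f) :=
  (succ_iff.mp hf).2.2

theorem nonneg (hf : BoundedDerivs r M n f) : 0 ≤ M := (norm_nonneg _).trans (hf.norm_le 0)

protected theorem add {F : Type u} [NormedAddCommGroup F] [NormedSpace ℝ F] {M M' : ℝ} :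
    ∀ {n : ℕ} {f g : E → F}, BoundedDerivs r M n f → BoundedDerivs r M' n g →
      BoundedDerivs r (M + M') n (fun x => f x + g x)
  | 0, _, _, hf, hg => zero_iff.mpr fun x => norm_add_le_of_le (hf.norm_le x) (hg.norm_le x)
  | n + 1, f, g, hf, hg => by
    refine succ_iff.mpr ⟨fun x => norm_add_le_of_le (hf.norm_le x) (hg.norm_le x),
      hf.differentiable.add hg.differentiable, ?_⟩
    have hderiv : fderiv ℝ (fun x => f x + g x) = fun x => fderiv ℝ f x + fderiv ℝ g x :=
      funext fun x => fderiv_fun_add (hf.differentiable x) (hg.differentiable x)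
    rw [hderiv, mul_add]
    exact hf.fderiv.add hg.fderiv

theorem clm_comp {F G : Type u} [NormedAddCommGroup F] [NormedSpace ℝ F] [NormedAddCommGroup G]
    [NormedSpace ℝ G] {M : ℝ} (T : F →L[ℝ] G) (hT : ‖T‖ ≤ 1) :
    ∀ {n : ℕ} {f : E → F}, BoundedDerivs r M n f → BoundedDerivs r M n (fun x => T (f x))
  | 0, _, hf => zero_iff.mpr fun x => (T.le_of_opNorm_le hT _).trans (by simpa using hf.norm_le x)
  | n + 1, f, hf => by
    refine succ_iff.mpr ⟨fun x => (T.le_of_opNorm_le hT _).trans (by simpa using hf.norm_le x),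
      T.differentiable.comp hf.differentiable, ?_⟩
    have hderiv : fderiv ℝ (fun x => T (f x)) =
        fun x => ContinuousLinearMap.compL ℝ E F G T (fderiv ℝ f x) :=
      funext fun x => (T.hasFDerivAt.comp x (hf.differentiable x).hasFDerivAt).fderiv
    have hcomp : ‖ContinuousLinearMap.compL ℝ E F G T‖ ≤ 1 :=
      ContinuousLinearMap.opNorm_le_bound _ zero_le_one fun S =>
        (T.opNorm_comp_le S).trans (mul_le_mul_of_nonneg_right hT (norm_nonneg S))
    rw [hderiv]
    exact hf.fderiv.clm_comp _ hcomp

theorem clm_apply₂ {F G H : Type u} [NormedAddCommGroup F] [NormedSpace ℝ F]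
    [NormedAddCommGroup G] [NormedSpace ℝ G] [NormedAddCommGroup H] [NormedSpace ℝ H]
    (B : F →L[ℝ] G →L[ℝ] H) (hB : ‖B‖ ≤ 1) :
    ∀ {M M' : ℝ} {n : ℕ} {f : E → F} {g : E → G}, BoundedDerivs r M n f → BoundedDerivs r M' n g →
      BoundedDerivs (2 * r) (M * M') n (fun x => B (f x) (g x)) := by
  intro M M' n f g hf hg
  have hle (x : E) : ‖B (f x) (g x)‖ ≤ M * M' :=
    (B.le_of_opNorm₂_le_of_le hB (hf.norm_le x) (hg.norm_le x)).trans_eq (by ring)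
  cases n with
  | zero => exact zero_iff.mpr hle
  | succ n =>
    refine succ_iff.mpr ⟨hle, ?_, ?_⟩
    · exact fun x => (B.hasFDerivAt_of_bilinear (hf.differentiable x).hasFDerivAt
        (hg.differentiable x).hasFDerivAt).differentiableAt
    have hderiv : fderiv ℝ (fun x => B (f x) (g x)) =
        fun x => B.precompR E (f x) (fderiv ℝ g x) + B.precompL E (fderiv ℝ f x) (g x) :=
      funext fun x => B.fderiv_of_bilinear (hf.differentiable x) (hg.differentiable x)
    rw [hderiv, show 2 * r * (M * M') = M * (r * M') + r * M * M' by ring]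
    exact .add
      ((hf.of_le n.le_succ).clm_apply₂ _ ((B.norm_precompR_le E).trans hB) hg.fderiv)
      (hf.fderiv.clm_apply₂ _ ((B.norm_precompL_le E).trans hB) (hg.of_le n.le_succ))
termination_by _ _ n => n

theorem norm_sub_le (hf : BoundedDerivs r M (n + 1) f) (x y : E) :
    ‖f x - f y‖ ≤ r * M * ‖x - y‖ :=
  convex_univ.norm_image_sub_le_of_norm_fderiv_le (fun x _ => hf.differentiable x)
    (fun x _ => hf.fderiv.norm_le x) (Set.mem_univ y) (Set.mem_univ x)

theorem norm_taylor_le (hf : BoundedDerivs r M (n + 2) f) (x u : E) :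
    ‖f (x + u) - f x - fderiv ℝ f x u‖ ≤ r ^ 2 * M * ‖u‖ ^ 2 := by
  have hfderiv : ∀ y ∈ Metric.closedBall x ‖u‖,
      ‖fderiv ℝ f y - fderiv ℝ f x‖ ≤ r ^ 2 * M * ‖u‖ := fun y hy =>
    calc ‖fderiv ℝ f y - fderiv ℝ f x‖ ≤ r * (r * M) * ‖y - x‖ := hf.fderiv.norm_sub_le y x
      _ ≤ r * (r * M) * ‖u‖ :=
        mul_le_mul_of_nonneg_left (mem_closedBall_iff_norm.mp hy) hf.fderiv.fderiv.nonneg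
      _ = r ^ 2 * M * ‖u‖ := by ring
  have key := (convex_closedBall x ‖u‖).norm_image_sub_le_of_norm_fderiv_le'
    (fun y _ => hf.differentiable y) hfderiv (Metric.mem_closedBall_self (norm_nonneg u))
    (y := x + u) (by simp)
  rw [add_sub_cancel_left] at key
  exact key.trans_eq (by ring)

theorem hasDerivAt_comp_line (hf : BoundedDerivs r M (n + 1) f) (x u : E) (θ : ℝ) :
    HasDerivAt (fun θ : ℝ => f (x + θ • u)) (fderiv ℝ f (x + θ • u) u) θ :=
  (hf.differentiable _).hasFDerivAt.comp_hasDerivAt θ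
    (by simpa using ((hasDerivAt_id θ).smul_const u).const_add x)

theorem norm_increment_sub_le (hf : BoundedDerivs r M (n + 2) f) (hx : ‖x - x'‖ ≤ S)
    (hxu : ‖x + u - (x' + u')‖ ≤ S) :
    ‖f (x + u) - f x - (f (x' + u') - f x')‖ ≤
      r ^ 2 * M * S * ‖u‖ + r * M * ‖u - u'‖ := by
  have hderiv : ∀ θ ∈ Set.Ico (0 : ℝ) 1,
      ‖fderiv ℝ f (x + θ • u) u - fderiv ℝ f (x' + θ • u') u'‖ ≤
        r ^ 2 * M * S * ‖u‖ + r * M * ‖u - u'‖ := by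
    intro θ hθ
    have hline := norm_lineSegment_sub_le hx hxu hθ.1 hθ.2.le
    calc ‖fderiv ℝ f (x + θ • u) u - fderiv ℝ f (x' + θ • u') u'‖
        = ‖(fderiv ℝ f (x + θ • u) - fderiv ℝ f (x' + θ • u')) u
            + fderiv ℝ f (x' + θ • u') (u - u')‖ := by
          rw [sub_apply, map_sub]; congr 1; abel
      _ ≤ r * (r * M) * S * ‖u‖ + r * M * ‖u - u'‖ := by
          refine norm_add_le_of_le (ContinuousLinearMap.le_of_opNorm_le _ ?_ u)
            (ContinuousLinearMap.le_of_opNorm_le _ (hf.fderiv.norm_le _) _)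
          exact (hf.fderiv.norm_sub_le _ _).trans
            (mul_le_mul_of_nonneg_left hline hf.fderiv.fderiv.nonneg)
      _ = r ^ 2 * M * S * ‖u‖ + r * M * ‖u - u'‖ := by ring
  have key := norm_image_sub_le_of_norm_deriv_le_segment_01'
    (fun θ _ => ((hf.hasDerivAt_comp_line x u θ).sub
      (hf.hasDerivAt_comp_line x' u' θ)).hasDerivWithinAt) hderiv
  simp only [Pi.sub_apply, one_smul, zero_smul, add_zero] at key
  rwa [sub_sub_sub_comm]

theorem norm_fderiv_apply_sub_le (hf : BoundedDerivs r M (n + 3) f) (hx : ‖x - x'‖ ≤ S)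
    (hxu : ‖x + u - (x' + u')‖ ≤ S) (hu : ‖u‖ ≤ U) (hu' : ‖u'‖ ≤ U) (huu' : ‖u - u'‖ ≤ V) {θ : ℝ}
    (hθ₀ : 0 ≤ θ) (hθ₁ : θ ≤ 1) :
    ‖fderiv ℝ f (x + θ • u) u - fderiv ℝ f x u
        - (fderiv ℝ f (x' + θ • u') u' - fderiv ℝ f x' u')‖ ≤
      (r ^ 3 * M * U ^ 2 * S + 2 * (r ^ 2 * M * U * V)) * θ := by
  have hr₂ : 0 ≤ r * (r * M) := hf.fderiv.fderiv.nonneg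
  have hr₃ : 0 ≤ r * (r * (r * M)) := hf.fderiv.fderiv.fderiv.nonneg
  have hS : 0 ≤ S := (norm_nonneg _).trans hx
  have hU : 0 ≤ U := (norm_nonneg _).trans hu
  have hV : 0 ≤ V := (norm_nonneg _).trans huu'
  have norm_smul_eq (v : E) : ‖θ • v‖ = θ * ‖v‖ := by
    rw [norm_smul, Real.norm_of_nonneg hθ₀]
  have hincrement := hf.fderiv.norm_increment_sub_le hx (norm_lineSegment_sub_le hx hxu hθ₀ hθ₁)
  have hlip := hf.fderiv.norm_sub_le (x' + θ • u') x'
  rw [← smul_sub, norm_smul_eq, norm_smul_eq] at hincrement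
  rw [add_sub_cancel_left, norm_smul_eq] at hlip
  calc ‖fderiv ℝ f (x + θ • u) u - fderiv ℝ f x u
        - (fderiv ℝ f (x' + θ • u') u' - fderiv ℝ f x' u')‖
      = ‖(fderiv ℝ f (x + θ • u) - fderiv ℝ f x
            - (fderiv ℝ f (x' + θ • u') - fderiv ℝ f x')) u
          + (fderiv ℝ f (x' + θ • u') - fderiv ℝ f x') (u - u')‖ := by
        simp only [sub_apply, map_sub]; congr 1; abel
    _ ≤ (r ^ 2 * (r * M) * S * (θ * ‖u‖) + r * (r * M) * (θ * ‖u - u'‖)) * ‖u‖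
          + r * (r * M) * (θ * ‖u'‖) * ‖u - u'‖ :=
        norm_add_le_of_le (ContinuousLinearMap.le_of_opNorm_le _ hincrement _)
          (ContinuousLinearMap.le_of_opNorm_le _ hlip _)
    _ = r * (r * (r * M)) * (S * θ * (‖u‖ * ‖u‖))
          + r * (r * M) * (θ * (‖u - u'‖ * ‖u‖ + ‖u'‖ * ‖u - u'‖)) := by ring
    _ ≤ r * (r * (r * M)) * (S * θ * (U * U)) + r * (r * M) * (θ * (V * U + U * V)) := by gcongr
    _ = (r ^ 3 * M * U ^ 2 * S + 2 * (r ^ 2 * M * U * V)) * θ := by ring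

theorem norm_taylor_sub_le (hf : BoundedDerivs r M (n + 3) f) (hx : ‖x - x'‖ ≤ S)
    (hxu : ‖x + u - (x' + u')‖ ≤ S) (hu : ‖u‖ ≤ U) (hu' : ‖u'‖ ≤ U) (huu' : ‖u - u'‖ ≤ V) :
    ‖f (x + u) - f x - fderiv ℝ f x u - (f (x' + u') - f x' - fderiv ℝ f x' u')‖ ≤
      r ^ 3 * M * U ^ 2 * S + r ^ 2 * M * U * V := by
  have hr₃ : 0 ≤ r ^ 3 * M * U ^ 2 * S :=
    mul_nonneg (mul_nonneg (hf.fderiv.fderiv.fderiv.nonneg.trans_eq (by ring)) (sq_nonneg U))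
      ((norm_nonneg _).trans hx)
  have key := norm_sub_le_half_of_norm_deriv_le
    (fun θ => ((hf.hasDerivAt_comp_line x u θ).sub ((hasDerivAt_id θ).smul_const _)).sub
      ((hf.hasDerivAt_comp_line x' u' θ).sub ((hasDerivAt_id θ).smul_const _)))
    (fun θ hθ => by
      simpa only [one_smul] using
        hf.norm_fderiv_apply_sub_le hx hxu hu hu' huu' hθ.1 hθ.2.le)
  simp only [Pi.sub_apply, one_smul, zero_smul, add_zero, id, sub_zero] at key
  calc ‖f (x + u) - f x - fderiv ℝ f x u - (f (x' + u') - f x' - fderiv ℝ f x' u')‖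
      = ‖f (x + u) - fderiv ℝ f x u - (f (x' + u') - fderiv ℝ f x' u') - (f x - f x')‖ := by
        congr 1; abel
    _ ≤ (r ^ 3 * M * U ^ 2 * S + 2 * (r ^ 2 * M * U * V)) / 2 := key
    _ ≤ r ^ 3 * M * U ^ 2 * S + r ^ 2 * M * U * V := by linarith

end BoundedDerivs
end Calculus

variable {E : Type u} [NormedAddCommGroup E] [NormedSpace ℝ E] {d d' : ℕ} {α M K L : ℝ}

theorem norm_sum_fin_le {G : Type*} [SeminormedAddCommGroup G] {v : Fin d' → G} {C : ℝ}
    (hv : ∀ j, ‖v j‖ ≤ C) : ‖∑ j, v j‖ ≤ d' * C :=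
  (norm_sum_le_of_le _ fun j _ => hv j).trans_eq (by simp)

theorem norm_sum_smul_le {ζ : Fin d' → ℝ} {v : Fin d' → E} {Q C : ℝ} (hζ : ‖ζ‖ ≤ Q)
    (hv : ∀ j, ‖v j‖ ≤ C) : ‖∑ j, ζ j • v j‖ ≤ d' * (Q * C) :=
  norm_sum_fin_le fun j => (norm_smul _ _).trans_le (mul_le_mul ((norm_le_pi_norm ζ j).trans hζ)
    (hv j) (norm_nonneg _) ((norm_nonneg ζ).trans hζ))

theorem norm_sum_sum_smul_le {η : Fin d' → Fin d' → ℝ} {v : Fin d' → Fin d' → E} {C : ℝ}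
    (hv : ∀ j m, ‖v j m‖ ≤ C) : ‖∑ j, ∑ m, η m j • v j m‖ ≤ d' ^ 2 * (‖η‖ * C) := by
  rw [pow_two, mul_assoc]
  exact norm_sum_fin_le fun j => norm_sum_smul_le (ζ := fun m => η m j)
    ((pi_norm_le_iff_of_nonneg (norm_nonneg η)).mpr fun m =>
      (norm_le_pi_norm (η m) j).trans (norm_le_pi_norm η m)) (hv j)

theorem le_rpow_sq {α x : ℝ} (hα : α ≤ 1 / 2) (hx₀ : 0 ≤ x) (hx₁ : x ≤ 1) : x ≤ (x ^ α) ^ 2 := by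
  rcases hx₀.eq_or_lt with rfl | hx
  · positivity
  · rw [← Real.rpow_natCast, ← Real.rpow_mul hx.le]
    simpa using Real.rpow_le_rpow_of_exponent_ge hx hx₁ (by push_cast; linarith : α * (2 : ℕ) ≤ 1)

/-- A rough differential equation `dX = drift(X) dt + ∑ j, diffusion j (X) dpath_j` in a normed
space, together with the second-order process `area` which enhances the driving path. -/
structure RoughEquation (E : Type u) (d' : ℕ) where
  drift : E → E
  diffusion : Fin d' → E → E
  path : ℝ → Fin d' → ℝ
  area : ℝ → ℝ → Fin d' → Fin d' → ℝ

namespace RoughEquation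

variable (R : RoughEquation E d')

/-- `∑ j, σ_j(x) ζ_j`, the first-order response to a displacement `ζ` of the driving path. -/
def linearTerm (ζ : Fin d' → ℝ) (x : E) : E := ∑ j, ζ j • R.diffusion j x

/-- `∑ j, ∑ m, Dσ_j(x) σ_m(x) η_{m,j}`, the second-order response to an area `η` of the driving
path. -/
noncomputable def areaTerm (η : Fin d' → Fin d' → ℝ) (x : E) : E :=
  ∑ j, ∑ m, η m j • fderiv ℝ (R.diffusion j) x (R.diffusion m x)

/-- The response at `x` to the driving path on `[s, t]`, up to second order. -/
noncomputable def noise (s t : ℝ) (x : E) : E :=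
  R.linearTerm (R.path t - R.path s) x + R.areaTerm (R.area s t) x

/-- The second-order Taylor increment over `[s, t]` of a solution which starts from `x`: the
coordinate-free form of `RoughMilstein.increment`. -/
noncomputable def increment (s t : ℝ) (x : E) : E := (t - s) • R.drift x + R.noise s t x

/-- The deviation of a step from `x` to `y` over `[s, t]` from the second-order increment. -/
noncomputable def remainder (s t : ℝ) (x y : E) : E := y - x - R.increment s t x

/-- The deviation of a step from `x` to `y` over `[s, t]` from the first-order increment. -/
def firstRemainder (s t : ℝ) (x y : E) : E :=
  y - x - ((t - s) • R.drift x + R.linearTerm (R.path t - R.path s) x)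

/-- The deviation of the difference of the steps `x ↦ y` and `x' ↦ y'` over `[s, t]` from the
difference of the responses to the driving path. -/
noncomputable def diffRemainder (s t : ℝ) (x y x' y' : E) : E :=
  (y - y') - (x - x') - (R.noise s t x - R.noise s t x')

/-- The standing assumptions of the error analysis: smooth and bounded coefficients, and a driving
path of Hölder exponent `α` with an area of Hölder exponent `2α` satisfying Chen's relation. -/
structure IsRegular (d : ℕ) (α M K L : ℝ) : Prop where
  exponent_mem : α ∈ Set.Ioc (1 / 3 : ℝ) (1 / 2)
  drift : BoundedDerivs d M 1 R.drift
  diffusion : ∀ j, BoundedDerivs d M 3 (R.diffusion j)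
  isArea : IsArea R.path R.area
  norm_path_sub_le : ∀ s t : ℝ, 0 ≤ s → s < t → t ≤ 1 → ‖R.path t - R.path s‖ ≤ K * (t - s) ^ α
  norm_area_le : ∀ s t : ℝ, 0 ≤ s → s < t → t ≤ 1 → ‖R.area s t‖ ≤ L * ((t - s) ^ α) ^ 2

variable {R} {r s t S c₁ c₂ b₁ b₂ : ℝ} {x y z x' y' : E}

theorem remainder_eq_firstRemainder_sub :
    R.remainder s t x y = R.firstRemainder s t x y - R.areaTerm (R.area s t) x := by
  unfold remainder firstRemainder increment noise
  abel

theorem areaTerm_add (η η' : Fin d' → Fin d' → ℝ) (x : E) :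
    R.areaTerm (η + η') x = R.areaTerm η x + R.areaTerm η' x := by
  simp only [areaTerm, Pi.add_apply, add_smul, Finset.sum_add_distrib]

theorem linearTerm_add (ζ ζ' : Fin d' → ℝ) (x : E) :
    R.linearTerm (ζ + ζ') x = R.linearTerm ζ x + R.linearTerm ζ' x := by
  simp only [linearTerm, Pi.add_apply, add_smul, Finset.sum_add_distrib]

theorem areaTerm_mul (ζ ζ' : Fin d' → ℝ) (x : E) :
    R.areaTerm (fun m j => ζ m * ζ' j) x =
      ∑ j, ζ' j • fderiv ℝ (R.diffusion j) x (R.linearTerm ζ x) := by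
  simp only [areaTerm, linearTerm, map_sum, map_smul, Finset.smul_sum, smul_smul]
  simp only [mul_comm]

theorem noise_add_noise_sub (harea : IsArea R.path R.area) (hr : 0 ≤ r) (hrs : r < s)
    (hst : s < t) (ht : t ≤ 1) (x y : E) :
    R.noise r s x + R.noise s t y - R.noise r t x =
      ∑ j, (R.path t - R.path s) j • (R.diffusion j y - R.diffusion j x
        - fderiv ℝ (R.diffusion j) x (R.linearTerm (R.path s - R.path r) x))
      + (R.areaTerm (R.area s t) y - R.areaTerm (R.area s t) x) := by
  have hchen : R.area r t = R.area r s + R.area s t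
      + fun m j => (R.path s - R.path r) m * (R.path t - R.path s) j := by
    funext m j
    exact harea r s t hr hrs hst ht m j
  have hpath : R.path t - R.path r = (R.path s - R.path r) + (R.path t - R.path s) := by abel
  simp only [smul_sub, Finset.sum_sub_distrib]
  rw [← areaTerm_mul]
  unfold noise
  rw [hchen, hpath, areaTerm_add, areaTerm_add, linearTerm_add]
  simp only [linearTerm]
  abel

theorem remainder_eq_add (r s t : ℝ) (x y z : E) : R.remainder r t x z =
    R.remainder r s x y + R.remainder s t y z
      + ((t - s) • (R.drift y - R.drift x) + (R.noise r s x + R.noise s t y - R.noise r t x)) := by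
  unfold remainder increment
  rw [← sub_add_sub_cancel t s r]
  module

theorem firstRemainder_eq_add (r s t : ℝ) (x y z : E) : R.firstRemainder r t x z =
    R.firstRemainder r s x y + R.firstRemainder s t y z
      + ((t - s) • (R.drift y - R.drift x)
        + (R.linearTerm (R.path t - R.path s) y - R.linearTerm (R.path t - R.path s) x)) := by
  unfold firstRemainder
  rw [← sub_add_sub_cancel t s r, ← sub_add_sub_cancel (R.path t) (R.path s) (R.path r),
    linearTerm_add]
  module

theorem diffRemainder_eq_add (r s t : ℝ) (x y z x' y' z' : E) : R.diffRemainder r t x z x' z' =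
    R.diffRemainder r s x y x' y' + R.diffRemainder s t y z y' z'
      + ((R.noise r s x + R.noise s t y - R.noise r t x)
        - (R.noise r s x' + R.noise s t y' - R.noise r t x')) := by
  unfold diffRemainder
  abel

namespace IsRegular

variable (hR : R.IsRegular d α M K L)
include hR

theorem bound_nonneg : 0 ≤ M := hR.drift.nonneg

theorem path_nonneg : 0 ≤ K := by
  simpa using (norm_nonneg _).trans (hR.norm_path_sub_le 0 1 le_rfl one_pos le_rfl)

theorem area_nonneg : 0 ≤ L := by
  simpa using (norm_nonneg _).trans (hR.norm_area_le 0 1 le_rfl one_pos le_rfl)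

theorem boundedDerivs_areaCoeff (j m : Fin d') : BoundedDerivs (2 * d) (d * M * M) 2
    (fun x => fderiv ℝ (R.diffusion j) x (R.diffusion m x)) :=
  (hR.diffusion j).fderiv.clm_apply₂ (ContinuousLinearMap.id ℝ (E →L[ℝ] E))
    ContinuousLinearMap.norm_id_le ((hR.diffusion m).of_le (by norm_num))

theorem norm_linearTerm_le (ζ : Fin d' → ℝ) (x : E) : ‖R.linearTerm ζ x‖ ≤ d' * M * ‖ζ‖ :=
  (norm_sum_smul_le le_rfl fun j => (hR.diffusion j).norm_le x).trans_eq (by ring)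

theorem norm_linearTerm_sub_le (ζ : Fin d' → ℝ) (x y : E) :
    ‖R.linearTerm ζ x - R.linearTerm ζ y‖ ≤ d * d' * M * ‖ζ‖ * ‖x - y‖ := by
  simp only [linearTerm, ← Finset.sum_sub_distrib, ← smul_sub]
  exact (norm_sum_smul_le le_rfl fun j => (hR.diffusion j).norm_sub_le x y).trans_eq (by ring)

theorem norm_areaTerm_le (η : Fin d' → Fin d' → ℝ) (x : E) :
    ‖R.areaTerm η x‖ ≤ d * d' ^ 2 * M ^ 2 * ‖η‖ :=
  (norm_sum_sum_smul_le fun j m => (hR.boundedDerivs_areaCoeff j m).norm_le x).trans_eq (by ring)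

theorem norm_areaTerm_sub_le (η : Fin d' → Fin d' → ℝ) (x y : E) :
    ‖R.areaTerm η x - R.areaTerm η y‖ ≤ 2 * d ^ 2 * d' ^ 2 * M ^ 2 * ‖η‖ * ‖x - y‖ := by
  simp only [areaTerm, ← Finset.sum_sub_distrib, ← smul_sub]
  exact (norm_sum_sum_smul_le fun j m =>
    (hR.boundedDerivs_areaCoeff j m).norm_sub_le x y).trans_eq (by ring)

theorem norm_areaTerm_increment_sub_le (η : Fin d' → Fin d' → ℝ) (hx : ‖x - x'‖ ≤ S)
    (hy : ‖y - y'‖ ≤ S) :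
    ‖R.areaTerm η y - R.areaTerm η x - (R.areaTerm η y' - R.areaTerm η x')‖ ≤
      d' ^ 2 * ‖η‖ * (4 * d ^ 3 * M ^ 2 * S * ‖y - x‖
        + 2 * d ^ 2 * M ^ 2 * ‖(y - x) - (y' - x')‖) := by
  simp only [areaTerm, ← Finset.sum_sub_distrib, ← smul_sub]
  refine (norm_sum_sum_smul_le fun j m => ?_).trans_eq (mul_assoc _ _ _).symm
  have key := (hR.boundedDerivs_areaCoeff j m).norm_increment_sub_le (u := y - x) (u' := y' - x') hx
    (by simpa only [add_sub_cancel] using hy)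
  simp only [add_sub_cancel] at key
  exact key.trans_eq (by ring)

end IsRegular

/-- The constant of the three-point estimate for the difference of two trajectories, given
constants `c₁`, `c₂` for the increments and first-order remainders of the trajectories and `b₁`,
`b₂` for those of their difference. -/
def diffKappa (d d' : ℕ) (M K L c₁ c₂ b₁ b₂ : ℝ) : ℝ :=
  d' * K * (d ^ 3 * M * c₁ ^ 2 + d ^ 2 * M * c₁ * b₁ + d ^ 2 * M * (M + c₂) + d * M * b₂)
    + d' ^ 2 * L * (4 * d ^ 3 * M ^ 2 * c₁ + 2 * d ^ 2 * M ^ 2 * b₁)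

namespace IsRegular

variable (hR : R.IsRegular d α M K L)
include hR

theorem exponent_pos : 0 < α := by linarith [hR.exponent_mem.1]

theorem sub_le_rpow_sq (hs : 0 ≤ s) (hst : s ≤ t) (ht : t ≤ 1) : t - s ≤ ((t - s) ^ α) ^ 2 :=
  le_rpow_sq hR.exponent_mem.2 (sub_nonneg.mpr hst) (by linarith)

theorem norm_path_sub_le_of_le (hr : 0 ≤ r) (hrs : r ≤ s) (hst : s < t) (ht : t ≤ 1) :
    ‖R.path t - R.path s‖ ≤ K * (t - r) ^ α :=
  (hR.norm_path_sub_le s t (hr.trans hrs) hst ht).trans (mul_le_mul_of_nonneg_left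
    (Real.rpow_le_rpow (sub_nonneg.mpr hst.le) (by linarith) hR.exponent_pos.le) hR.path_nonneg)

theorem norm_area_le_of_le (hr : 0 ≤ r) (hrs : r ≤ s) (hst : s < t) (ht : t ≤ 1) :
    ‖R.area s t‖ ≤ L * ((t - r) ^ α) ^ 2 := by
  have hrpow : (t - s) ^ α ≤ (t - r) ^ α :=
    Real.rpow_le_rpow (sub_nonneg.mpr hst.le) (by linarith) hR.exponent_pos.le
  have : 0 ≤ (t - s) ^ α := Real.rpow_nonneg (sub_nonneg.mpr hst.le) α
  have : 0 ≤ L := hR.area_nonneg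
  exact (hR.norm_area_le s t (hr.trans hrs) hst ht).trans (by gcongr)

section Taylor

variable {ω : ℝ} (hrs : r ≤ s) (hω : s - r ≤ ω ^ 2)
include hrs hω

theorem norm_smul_drift_le (x : E) : ‖(s - r) • R.drift x‖ ≤ M * ω ^ 2 := by
  rw [norm_smul, Real.norm_of_nonneg (sub_nonneg.mpr hrs), mul_comm]
  exact mul_le_mul (hR.drift.norm_le x) hω (sub_nonneg.mpr hrs) hR.bound_nonneg

theorem norm_sub_linearTerm_le (h₂ : ‖R.firstRemainder r s x y‖ ≤ c₂ * ω ^ 2) :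
    ‖y - x - R.linearTerm (R.path s - R.path r) x‖ ≤ (c₂ + M) * ω ^ 2 := by
  have hsplit : y - x - R.linearTerm (R.path s - R.path r) x =
      R.firstRemainder r s x y + (s - r) • R.drift x := by
    unfold firstRemainder
    abel
  rw [hsplit, add_mul]
  exact norm_add_le_of_le h₂ (hR.norm_smul_drift_le hrs hω x)

theorem norm_diffusion_taylor_le (h₁ : ‖y - x‖ ≤ c₁ * ω)
    (h₂ : ‖R.firstRemainder r s x y‖ ≤ c₂ * ω ^ 2) (j : Fin d') :
    ‖R.diffusion j y - R.diffusion j x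
        - fderiv ℝ (R.diffusion j) x (R.linearTerm (R.path s - R.path r) x)‖ ≤
      (d ^ 2 * M * c₁ ^ 2 + d * M * (c₂ + M)) * ω ^ 2 := by
  have : 0 ≤ M := hR.bound_nonneg
  obtain ⟨u, rfl⟩ : ∃ u, y = x + u := ⟨y - x, by abel⟩
  rw [add_sub_cancel_left] at h₁
  set ℓ := R.linearTerm (R.path s - R.path r) x
  have hu : ‖u - ℓ‖ ≤ (c₂ + M) * ω ^ 2 := by
    simpa only [add_sub_cancel_left] using hR.norm_sub_linearTerm_le hrs hω h₂
  have hsplit : R.diffusion j (x + u) - R.diffusion j x - fderiv ℝ (R.diffusion j) x ℓ =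
      (R.diffusion j (x + u) - R.diffusion j x - fderiv ℝ (R.diffusion j) x u)
        + fderiv ℝ (R.diffusion j) x (u - ℓ) := by
    rw [map_sub]
    abel
  rw [hsplit]
  calc _ ≤ d ^ 2 * M * ‖u‖ ^ 2 + d * M * ‖u - ℓ‖ :=
        norm_add_le_of_le ((hR.diffusion j).norm_taylor_le x u)
          ((fderiv ℝ _ x).le_of_opNorm_le ((hR.diffusion j).fderiv.norm_le x) _)
    _ ≤ d ^ 2 * M * (c₁ * ω) ^ 2 + d * M * ((c₂ + M) * ω ^ 2) := by gcongr
    _ = _ := by ring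

theorem norm_diffusion_taylor_sub_le (hx : ‖x - x'‖ ≤ S) (hy : ‖y - y'‖ ≤ S)
    (h₁ : ‖y - x‖ ≤ c₁ * ω) (h₁' : ‖y' - x'‖ ≤ c₁ * ω)
    (h₂ : ‖R.firstRemainder r s x' y'‖ ≤ c₂ * ω ^ 2)
    (h₃ : ‖(y - y') - (x - x')‖ ≤ b₁ * S * ω)
    (h₄ : ‖(y - y') - (x - x') - (R.linearTerm (R.path s - R.path r) x
      - R.linearTerm (R.path s - R.path r) x')‖ ≤ b₂ * S * ω ^ 2) (j : Fin d') :
    ‖R.diffusion j y - R.diffusion j x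
        - fderiv ℝ (R.diffusion j) x (R.linearTerm (R.path s - R.path r) x)
        - (R.diffusion j y' - R.diffusion j x'
        - fderiv ℝ (R.diffusion j) x' (R.linearTerm (R.path s - R.path r) x'))‖ ≤
      (d ^ 3 * M * c₁ ^ 2 + d ^ 2 * M * c₁ * b₁ + d ^ 2 * M * (M + c₂) + d * M * b₂)
        * (S * ω ^ 2) := by
  have : 0 ≤ M := hR.bound_nonneg
  have hS : 0 ≤ S := (norm_nonneg _).trans hx
  have hu' := hR.norm_sub_linearTerm_le hrs hω h₂
  obtain ⟨u, rfl⟩ : ∃ u, y = x + u := ⟨y - x, by abel⟩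
  obtain ⟨u', rfl⟩ : ∃ u', y' = x' + u' := ⟨y' - x', by abel⟩
  rw [add_sub_add_comm, add_sub_cancel_left] at h₃ h₄
  rw [add_sub_cancel_left] at h₁ h₁' hu'
  set ℓ := R.linearTerm (R.path s - R.path r) x
  set ℓ' := R.linearTerm (R.path s - R.path r) x'
  set D := fderiv ℝ (R.diffusion j)
  have hsplit : R.diffusion j (x + u) - R.diffusion j x - D x ℓ
      - (R.diffusion j (x' + u') - R.diffusion j x' - D x' ℓ') =
      (R.diffusion j (x + u) - R.diffusion j x - D x u
        - (R.diffusion j (x' + u') - R.diffusion j x' - D x' u'))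
      + (D x - D x') (u' - ℓ') + D x ((u - u') - (ℓ - ℓ')) := by
    simp only [map_sub, sub_apply]
    abel
  have hD : ‖D x - D x'‖ ≤ d * (d * M) * S :=
    ((hR.diffusion j).fderiv.norm_sub_le x x').trans (by gcongr)
  rw [hsplit]
  calc _ ≤ (d ^ 3 * M * (c₁ * ω) ^ 2 * S + d ^ 2 * M * (c₁ * ω) * (b₁ * S * ω))
        + d * (d * M) * S * ‖u' - ℓ'‖ + d * M * ‖(u - u') - (ℓ - ℓ')‖ :=
        norm_add_le_of_le (norm_add_le_of_le
          ((hR.diffusion j).norm_taylor_sub_le hx hy h₁ h₁' h₃)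
          (ContinuousLinearMap.le_of_opNorm_le _ hD _))
          ((D x).le_of_opNorm_le ((hR.diffusion j).fderiv.norm_le x) _)
    _ ≤ (d ^ 3 * M * (c₁ * ω) ^ 2 * S + d ^ 2 * M * (c₁ * ω) * (b₁ * S * ω))
        + d * (d * M) * S * ((c₂ + M) * ω ^ 2) + d * M * (b₂ * S * ω ^ 2) := by gcongr
    _ = _ := by ring

end Taylor

section ThreePoint

variable (hr : 0 ≤ r) (hrs : r < s) (hst : s < t) (ht : t ≤ 1)
include hr hrs hst ht

theorem norm_noise_three_point_le (h₁ : ‖y - x‖ ≤ c₁ * (t - r) ^ α)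
    (h₂ : ‖R.firstRemainder r s x y‖ ≤ c₂ * ((t - r) ^ α) ^ 2) :
    ‖R.noise r s x + R.noise s t y - R.noise r t x‖ ≤
      (d' * K * (d ^ 2 * M * c₁ ^ 2 + d * M * (c₂ + M)) + 2 * d ^ 2 * d' ^ 2 * M ^ 2 * L * c₁)
        * ((t - r) ^ α) ^ 3 := by
  have hL := hR.area_nonneg
  have : 0 ≤ M := hR.bound_nonneg
  have hsub := hR.sub_le_rpow_sq hr (hrs.trans hst).le ht
  have hpath := hR.norm_path_sub_le_of_le hr hrs.le hst ht
  have harea := hR.norm_area_le_of_le hr hrs.le hst ht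
  have htaylor := hR.norm_diffusion_taylor_le hrs.le (by linarith) h₁ h₂
  set ω := (t - r) ^ α
  rw [noise_add_noise_sub hR.isArea hr hrs hst ht]
  calc _ ≤ d' * (K * ω * ((d ^ 2 * M * c₁ ^ 2 + d * M * (c₂ + M)) * ω ^ 2))
        + 2 * d ^ 2 * d' ^ 2 * M ^ 2 * ‖R.area s t‖ * ‖y - x‖ :=
        norm_add_le_of_le (norm_sum_smul_le hpath htaylor) (hR.norm_areaTerm_sub_le _ _ _)
    _ ≤ d' * (K * ω * ((d ^ 2 * M * c₁ ^ 2 + d * M * (c₂ + M)) * ω ^ 2))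
        + 2 * d ^ 2 * d' ^ 2 * M ^ 2 * (L * ω ^ 2) * (c₁ * ω) := by gcongr
    _ = _ := by ring

theorem norm_remainder_three_point_le (z : E) (h₁ : ‖y - x‖ ≤ c₁ * (t - r) ^ α)
    (h₂ : ‖R.firstRemainder r s x y‖ ≤ c₂ * ((t - r) ^ α) ^ 2) :
    ‖R.remainder r t x z‖ ≤ ‖R.remainder r s x y‖ + ‖R.remainder s t y z‖
      + kappa d d' M K L c₁ c₂ * ((t - r) ^ α) ^ 3 := by
  have : 0 ≤ M := hR.bound_nonneg
  have hdrift := hR.drift.norm_sub_le y x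
  have hω := hR.sub_le_rpow_sq hr (hrs.trans hst).le ht
  rw [remainder_eq_add r s t x y z]
  refine norm_add_le_of_le (norm_add_le _ _) ?_
  have hsmul : ‖(t - s) • (R.drift y - R.drift x)‖ ≤
      ((t - r) ^ α) ^ 2 * (d * M * (c₁ * (t - r) ^ α)) := by
    rw [norm_smul, Real.norm_of_nonneg (sub_nonneg.mpr hst.le)]
    exact mul_le_mul (by linarith) (hdrift.trans (by gcongr)) (norm_nonneg _) (by positivity)
  calc _ ≤ _ + _ := norm_add_le_of_le hsmul (hR.norm_noise_three_point_le hr hrs hst ht h₁ h₂)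
    _ = _ := by
        unfold kappa
        ring

theorem norm_firstRemainder_three_point_le (z : E) (hc₁ : 0 ≤ c₁)
    (h₁ : ‖y - x‖ ≤ c₁ * (t - r) ^ α) :
    ‖R.firstRemainder r t x z‖ ≤ ‖R.firstRemainder r s x y‖ + ‖R.firstRemainder s t y z‖
      + (d * M * c₁ + d * d' * M * K * c₁) * ((t - r) ^ α) ^ 2 := by
  have : 0 ≤ M := hR.bound_nonneg
  have hK := hR.path_nonneg
  have hω₀ : 0 ≤ (t - r) ^ α := Real.rpow_nonneg (by linarith) α
  have hsq := hR.sub_le_rpow_sq hr (hrs.trans hst).le ht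
  have hpath := hR.norm_path_sub_le_of_le hr hrs.le hst ht
  have hω : (t - r) ^ α ≤ 1 :=
    Real.rpow_le_one (by linarith) (by linarith) hR.exponent_pos.le
  rw [firstRemainder_eq_add r s t x y z]
  refine norm_add_le_of_le (norm_add_le _ _) ?_
  have hdrift : ‖(t - s) • (R.drift y - R.drift x)‖ ≤
      ((t - r) ^ α) ^ 2 * (d * M * (c₁ * (t - r) ^ α)) := by
    rw [norm_smul, Real.norm_of_nonneg (sub_nonneg.mpr hst.le)]
    exact mul_le_mul (by linarith) ((hR.drift.norm_sub_le y x).trans (by gcongr)) (norm_nonneg _)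
      (by positivity)
  have hlinear : ‖R.linearTerm (R.path t - R.path s) y - R.linearTerm (R.path t - R.path s) x‖ ≤
      d * d' * M * (K * (t - r) ^ α) * (c₁ * (t - r) ^ α) :=
    (hR.norm_linearTerm_sub_le _ _ _).trans (by gcongr)
  calc _ ≤ _ + _ := norm_add_le_of_le hdrift hlinear
    _ = d * M * ((t - r) ^ α) ^ 2 * (c₁ * (t - r) ^ α)
        + d * d' * M * K * c₁ * ((t - r) ^ α) ^ 2 := by ring
    _ ≤ d * M * ((t - r) ^ α) ^ 2 * c₁ + d * d' * M * K * c₁ * ((t - r) ^ α) ^ 2 := by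
        gcongr
        exact mul_le_of_le_one_right hc₁ hω
    _ = _ := by ring

theorem norm_noise_three_point_sub_le (hx : ‖x - x'‖ ≤ S) (hy : ‖y - y'‖ ≤ S)
    (h₁ : ‖y - x‖ ≤ c₁ * (t - r) ^ α) (h₁' : ‖y' - x'‖ ≤ c₁ * (t - r) ^ α)
    (h₂ : ‖R.firstRemainder r s x' y'‖ ≤ c₂ * ((t - r) ^ α) ^ 2)
    (h₃ : ‖(y - y') - (x - x')‖ ≤ b₁ * S * (t - r) ^ α)
    (h₄ : ‖(y - y') - (x - x') - (R.linearTerm (R.path s - R.path r) x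
      - R.linearTerm (R.path s - R.path r) x')‖ ≤ b₂ * S * ((t - r) ^ α) ^ 2) :
    ‖(R.noise r s x + R.noise s t y - R.noise r t x)
        - (R.noise r s x' + R.noise s t y' - R.noise r t x')‖ ≤
      diffKappa d d' M K L c₁ c₂ b₁ b₂ * S * ((t - r) ^ α) ^ 3 := by
  have : 0 ≤ M := hR.bound_nonneg
  have hL := hR.area_nonneg
  have hS : 0 ≤ S := (norm_nonneg _).trans hx
  have hpath := hR.norm_path_sub_le_of_le hr hrs.le hst ht
  have harea := hR.norm_area_le_of_le hr hrs.le hst ht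
  have htaylor := hR.norm_diffusion_taylor_sub_le hrs.le
    (by linarith [hR.sub_le_rpow_sq hr (hrs.trans hst).le ht]) hx hy h₁ h₁' h₂ h₃ h₄
  set ω := (t - r) ^ α
  set Q := d ^ 3 * M * c₁ ^ 2 + d ^ 2 * M * c₁ * b₁ + d ^ 2 * M * (M + c₂) + d * M * b₂
  have hincrement : ‖(y - x) - (y' - x')‖ ≤ b₁ * S * ω := by rwa [sub_sub_sub_comm]
  rw [noise_add_noise_sub hR.isArea hr hrs hst ht, noise_add_noise_sub hR.isArea hr hrs hst ht,
    add_sub_add_comm, ← Finset.sum_sub_distrib]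
  simp only [← smul_sub]
  calc _ ≤ d' * (K * ω * (Q * (S * ω ^ 2)))
        + d' ^ 2 * ‖R.area s t‖ * (4 * d ^ 3 * M ^ 2 * S * ‖y - x‖
          + 2 * d ^ 2 * M ^ 2 * ‖(y - x) - (y' - x')‖) :=
        norm_add_le_of_le (norm_sum_smul_le hpath htaylor)
          (hR.norm_areaTerm_increment_sub_le _ hx hy)
    _ ≤ d' * (K * ω * (Q * (S * ω ^ 2)))
        + d' ^ 2 * (L * ω ^ 2) * (4 * d ^ 3 * M ^ 2 * S * (c₁ * ω)
          + 2 * d ^ 2 * M ^ 2 * (b₁ * S * ω)) := by gcongr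
    _ = _ := by
        unfold diffKappa
        ring

end ThreePoint

section OneStep

variable (hs : 0 ≤ s) (hst : s < t) (ht : t ≤ 1)
include hs hst ht

theorem rpow_sq_le_rpow : ((t - s) ^ α) ^ 2 ≤ (t - s) ^ α :=
  pow_le_of_le_one (Real.rpow_nonneg (sub_nonneg.mpr hst.le) α)
    (Real.rpow_le_one (sub_nonneg.mpr hst.le) (by linarith) hR.exponent_pos.le) two_ne_zero

theorem norm_firstRemainder_le (h : ‖R.remainder s t x y‖ ≤ ((t - s) ^ α) ^ 2) :
    ‖R.firstRemainder s t x y‖ ≤ locC2 d d' M L * ((t - s) ^ α) ^ 2 := by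
  have : 0 ≤ M := hR.bound_nonneg
  have harea := hR.norm_area_le s t hs hst ht
  rw [← sub_add_cancel (R.firstRemainder s t x y), ← remainder_eq_firstRemainder_sub]
  calc _ ≤ ((t - s) ^ α) ^ 2 + d * d' ^ 2 * M ^ 2 * ‖R.area s t‖ :=
        norm_add_le_of_le h (hR.norm_areaTerm_le _ _)
    _ ≤ ((t - s) ^ α) ^ 2 + d * d' ^ 2 * M ^ 2 * (L * ((t - s) ^ α) ^ 2) := by gcongr
    _ = _ := by
        unfold locC2
        ring

theorem norm_sub_le_of_firstRemainder_le {c : ℝ} (hc : 0 ≤ c)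
    (h : ‖R.firstRemainder s t x y‖ ≤ c * ((t - s) ^ α) ^ 2) :
    ‖y - x‖ ≤ (c + M + d' * M * K) * (t - s) ^ α := by
  have : 0 ≤ M := hR.bound_nonneg
  have hpath := hR.norm_path_sub_le s t hs hst ht
  have hdrift := hR.norm_smul_drift_le hst.le (hR.sub_le_rpow_sq hs hst.le ht) x
  have hsq := hR.rpow_sq_le_rpow hs hst ht
  rw [← sub_add_cancel (y - x) ((t - s) • R.drift x + R.linearTerm (R.path t - R.path s) x)]
  calc _ ≤ c * ((t - s) ^ α) ^ 2
        + (M * ((t - s) ^ α) ^ 2 + d' * M * ‖R.path t - R.path s‖) :=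
        norm_add_le_of_le h (norm_add_le_of_le hdrift (hR.norm_linearTerm_le _ _))
    _ ≤ c * (t - s) ^ α + (M * (t - s) ^ α + d' * M * (K * (t - s) ^ α)) := by gcongr
    _ = _ := by ring

theorem norm_sub_le_of_remainder_le (h : ‖R.remainder s t x y‖ ≤ ((t - s) ^ α) ^ 2) :
    ‖y - x‖ ≤ locC1 d d' M K L * (t - s) ^ α := by
  have hL := hR.area_nonneg
  refine (hR.norm_sub_le_of_firstRemainder_le hs hst ht (by unfold locC2; positivity)
    (hR.norm_firstRemainder_le hs hst ht h)).trans_eq ?_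
  unfold locC1 locC2
  ring

theorem norm_sub_sub_linearTerm_le (hx : ‖x - x'‖ ≤ S)
    (h : ‖R.diffRemainder s t x y x' y'‖ ≤ (1 + d * M) * S * ((t - s) ^ α) ^ 2) :
    ‖(y - y') - (x - x') - (R.linearTerm (R.path t - R.path s) x
      - R.linearTerm (R.path t - R.path s) x')‖ ≤ locB2 d d' M L * S * ((t - s) ^ α) ^ 2 := by
  have : 0 ≤ M := hR.bound_nonneg
  have hL := hR.area_nonneg
  have harea := hR.norm_area_le s t hs hst ht
  have hsplit : (y - y') - (x - x') - (R.linearTerm (R.path t - R.path s) x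
      - R.linearTerm (R.path t - R.path s) x') = R.diffRemainder s t x y x' y'
        + (R.areaTerm (R.area s t) x - R.areaTerm (R.area s t) x') := by
    unfold diffRemainder noise
    abel
  rw [hsplit]
  calc _ ≤ (1 + d * M) * S * ((t - s) ^ α) ^ 2
        + 2 * d ^ 2 * d' ^ 2 * M ^ 2 * ‖R.area s t‖ * ‖x - x'‖ :=
        norm_add_le_of_le h (hR.norm_areaTerm_sub_le _ _ _)
    _ ≤ (1 + d * M) * S * ((t - s) ^ α) ^ 2
        + 2 * d ^ 2 * d' ^ 2 * M ^ 2 * (L * ((t - s) ^ α) ^ 2) * S := by gcongr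
    _ = _ := by
        unfold locB2
        ring

theorem norm_sub_sub_le (hx : ‖x - x'‖ ≤ S)
    (h : ‖R.diffRemainder s t x y x' y'‖ ≤ (1 + d * M) * S * ((t - s) ^ α) ^ 2) :
    ‖(y - y') - (x - x')‖ ≤ locB1 d d' M K L * S * (t - s) ^ α := by
  have : 0 ≤ M := hR.bound_nonneg
  have hK := hR.path_nonneg
  have hL := hR.area_nonneg
  have hS : 0 ≤ S := (norm_nonneg _).trans hx
  have hpath := hR.norm_path_sub_le s t hs hst ht
  have hsq := hR.rpow_sq_le_rpow hs hst ht
  have hB : 0 ≤ locB2 d d' M L := by unfold locB2; positivity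
  rw [← sub_add_cancel ((y - y') - (x - x')) (R.linearTerm (R.path t - R.path s) x
    - R.linearTerm (R.path t - R.path s) x')]
  calc _ ≤ locB2 d d' M L * S * ((t - s) ^ α) ^ 2
        + d * d' * M * ‖R.path t - R.path s‖ * ‖x - x'‖ :=
        norm_add_le_of_le (hR.norm_sub_sub_linearTerm_le hs hst ht hx h)
          (hR.norm_linearTerm_sub_le _ _ _)
    _ ≤ locB2 d d' M L * S * (t - s) ^ α + d * d' * M * (K * (t - s) ^ α) * S := by gcongr
    _ = _ := by
        unfold locB1 locB2
        ring

end OneStep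
end IsRegular
end RoughEquation

/-- The times `τ 0 < τ 1 < ⋯ < τ N` form a grid of step size `h` in `[0, 1]`. -/
structure UniformGrid (h : ℝ) (N : ℕ) (τ : ℕ → ℝ) : Prop where
  pos : 0 < h
  nonneg : 0 ≤ τ 0
  sub_eq : ∀ k l, τ l - τ k = ((l : ℝ) - k) * h
  le_one : τ N ≤ 1

namespace UniformGrid

variable {h : ℝ} {N k l m : ℕ} {τ : ℕ → ℝ} (hτ : UniformGrid h N τ)
include hτ

theorem strictMono : StrictMono τ := strictMono_nat_of_lt_succ fun k => by
  have := hτ.sub_eq k (k + 1)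
  push_cast at this
  linarith [hτ.pos]

theorem succ_sub (k : ℕ) : τ (k + 1) - τ k = h := by
  rw [hτ.sub_eq]
  push_cast
  ring

theorem nonneg_apply (k : ℕ) : 0 ≤ τ k := hτ.nonneg.trans (hτ.strictMono.monotone k.zero_le)

theorem apply_le_one (hk : k ≤ N) : τ k ≤ 1 := (hτ.strictMono.monotone hk).trans hτ.le_one

theorem shift {N' : ℕ} (h' : m + N' ≤ N) : UniformGrid h N' fun k => τ (m + k) where
  pos := hτ.pos
  nonneg := hτ.nonneg_apply _
  sub_eq k l := by
    rw [hτ.sub_eq]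
    push_cast
    ring
  le_one := hτ.apply_le_one h'

theorem sub_le_half {i j : ℕ} (hij : i ≤ j) (hkl : k ≤ l) (h' : 2 * (j - i) ≤ l - k) :
    τ j - τ i ≤ (τ l - τ k) / 2 := by
  have hcast : 2 * ((j : ℝ) - i) ≤ (l : ℝ) - k := by
    rw [← Nat.cast_sub hij, ← Nat.cast_sub hkl]
    exact_mod_cast h'
  rw [hτ.sub_eq, hτ.sub_eq]
  nlinarith [hτ.pos]

end UniformGrid

theorem two_mul_rpow_cube_le {α x y : ℝ} (hα : 0 ≤ α) (hx : 0 ≤ x) (hxy : x ≤ y / 2) :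
    2 * (x ^ α) ^ 3 ≤ 2 ^ (1 - 3 * α) * (y ^ α) ^ 3 := by
  have hy : 0 ≤ y := by linarith
  have hhalf : x ^ α ≤ y ^ α / 2 ^ α := by
    rw [← Real.div_rpow hy zero_le_two]
    exact Real.rpow_le_rpow hx hxy hα
  have htwo : (2 : ℝ) ^ (1 - 3 * α) = 2 / (2 ^ α) ^ 3 := by
    rw [Real.rpow_sub two_pos, Real.rpow_one, mul_comm, Real.rpow_mul zero_le_two]
    norm_cast
  calc 2 * (x ^ α) ^ 3 ≤ 2 * (y ^ α / 2 ^ α) ^ 3 := by gcongr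
    _ = _ := by
      rw [htwo, div_pow]
      ring

theorem UniformGrid.sewing {α h c κ ε : ℝ} {N : ℕ} {τ : ℕ → ℝ} {e : ℕ → ℕ → ℝ} (hα : 0 ≤ α)
    (hτ : UniformGrid h N τ) (hc : 0 ≤ c) (hκ : 0 ≤ κ) (hcκ : 2 * κ ≤ (1 - 2 ^ (1 - 3 * α)) * c)
    (hstep : ∀ k < N, e k (k + 1) ≤ ε * h)
    (hsplit : ∀ k m l, k < m → m < l → l ≤ N →
      e k m ≤ c * ((τ m - τ k) ^ α) ^ 3 + ε * (τ m - τ k) →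
      e k l ≤ e k m + e m l + κ * ((τ l - τ k) ^ α) ^ 3)
    {k l : ℕ} (hkl : k < l) (hl : l ≤ N) :
    e k l ≤ c * ((τ l - τ k) ^ α) ^ 3 + ε * (τ l - τ k) := by
  induction hn : l - k using Nat.strong_induction_on generalizing k l with
  | _ n ih =>
  subst hn
  have hnonneg (i j : ℕ) (hij : i ≤ j) : 0 ≤ τ j - τ i :=
    sub_nonneg.mpr (hτ.strictMono.monotone hij)
  set Y := ((τ l - τ k) ^ α) ^ 3
  have hY : 0 ≤ Y := pow_nonneg (Real.rpow_nonneg (hnonneg k l hkl.le) α) 3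
  have hhalf {i j : ℕ} (hij : i < j) (hj : j ≤ N) (h2 : 2 * (j - i) ≤ l - k) (hlt : j - i < l - k) :
      e i j ≤ 2 ^ (1 - 3 * α) * c * Y / 2 + ε * (τ j - τ i) := by
    have := mul_le_mul_of_nonneg_left (two_mul_rpow_cube_le hα (hnonneg i j hij.le)
      (hτ.sub_le_half hij.le hkl.le h2)) hc
    linarith [ih _ hlt hij hj rfl]
  obtain rfl | hkl' := (Nat.succ_le_of_lt hkl).eq_or_lt
  · rw [Nat.succ_eq_add_one, hτ.succ_sub]
    exact (hstep k hl).trans (le_add_of_nonneg_left (mul_nonneg hc hY))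
  obtain ⟨m, hm⟩ : ∃ m, m = (k + l) / 2 := ⟨_, rfl⟩
  have hkm : k < m := by omega
  have hml : m < l := by omega
  have hleft := hhalf hkm (by omega) (by omega) (by omega)
  have hsplit₁ := hsplit k m l hkm hml hl (ih _ (by omega) hkm (by omega) rfl)
  have hright : e m l ≤ 2 ^ (1 - 3 * α) * c * Y / 2 + ε * (τ l - τ m) + κ * Y := by
    have hκY : κ * ((τ l - τ m) ^ α) ^ 3 ≤ κ * Y :=
      mul_le_mul_of_nonneg_left (pow_le_pow_left₀ (Real.rpow_nonneg (hnonneg m l hml.le) α)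
        (Real.rpow_le_rpow (hnonneg m l hml.le) (by linarith [hnonneg k m hkm.le]) hα) 3) hκ
    obtain rfl | hml' := (Nat.succ_le_of_lt hml).eq_or_lt
    · have := mul_nonneg hκ hY
      linarith [hhalf hml hl (by omega) (by omega)]
    · have hsplit₂ := hsplit m (m + 1) l (by omega) hml' hl
        (ih _ (by omega) (by omega) (by omega) rfl)
      have hstep := hstep m (by omega)
      rw [← hτ.succ_sub m] at hstep
      linarith [hhalf hml' hl (by omega) (by omega)]
  linarith [mul_le_mul_of_nonneg_right hcκ hY]

namespace UniformGrid

variable {h δ : ℝ} {N k l : ℕ} {τ : ℕ → ℝ} (hτ : UniformGrid h N τ)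
include hτ

theorem exists_sub_mem_Icc (hδ : 3 * h ≤ δ) (hkl : δ < τ l - τ k) :
    ∃ m, k < m ∧ m < l ∧ τ m - τ k ∈ Set.Icc (2 * δ / 3) δ := by
  have hh := hτ.pos
  have hfloor : (⌊δ / h⌋₊ : ℝ) * h ≤ δ := by
    rw [← le_div_iff₀ hh]
    exact Nat.floor_le (div_nonneg (by linarith) hh.le)
  have hlt : δ < (⌊δ / h⌋₊ + 1) * h := by
    rw [← div_lt_iff₀ hh]
    exact Nat.lt_floor_add_one _
  have hspan : τ (k + ⌊δ / h⌋₊) - τ k = ⌊δ / h⌋₊ * h := by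
    rw [hτ.sub_eq]
    push_cast
    ring
  refine ⟨k + ⌊δ / h⌋₊, hτ.strictMono.lt_iff_lt.mp ?_, hτ.strictMono.lt_iff_lt.mp ?_, ?_⟩
  · linarith
  · linarith
  · rw [hspan]
    constructor <;> linarith

theorem exists_patching (hδ : 3 * h ≤ δ) (hδ' : δ ≤ 1 / 2) {P : ℕ → ℕ → Prop}
    (hone : ∀ k < l, τ l - τ k ≤ δ → P 1 k)
    (hsucc : ∀ p k m, k < m → m < l → τ m - τ k ≤ δ → P p m → P (p + 1) k)
    (hkl : k < l) (hl : l ≤ N) : ∃ p : ℕ, (p : ℝ) ≤ 2 / δ ∧ P p k := by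
  have hδ₀ : 0 < δ := by linarith [hτ.pos]
  have hcount (n : ℕ) : ∀ k, k < l → l - k = n →
      ∃ p : ℕ, p * (2 * δ / 3) ≤ τ l - τ k + 2 * δ / 3 ∧ P p k := by
    induction n using Nat.strong_induction_on with
    | _ n ih =>
      intro k hkl hn
      rcases le_or_gt (τ l - τ k) δ with hle | hlt
      · have := hτ.strictMono hkl
        exact ⟨1, by push_cast; linarith, hone k hkl hle⟩
      · obtain ⟨m, hkm, hml, hlower, hupper⟩ := hτ.exists_sub_mem_Icc hδ hlt
        obtain ⟨p, hp, hP⟩ := ih (l - m) (by omega) m hml rfl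
        exact ⟨p + 1, by push_cast; linarith, hsucc p k m hkm hml hupper hP⟩
  obtain ⟨p, hp, hP⟩ := hcount _ k hkl rfl
  refine ⟨p, (le_div_iff₀ hδ₀).mpr ?_, hP⟩
  linarith [hτ.apply_le_one hl, hτ.nonneg_apply k]

theorem le_two_div_mul {α a b : ℝ} {q : ℕ} {f : ℕ → ℕ → ℝ} (hδ : 3 * h ≤ δ) (hδ' : δ ≤ 1 / 2)
    (hα : 0 ≤ α) (ha : 0 ≤ a) (hb : 0 ≤ b)
    (hlocal : ∀ i j, i < j → j ≤ N → τ j - τ i ≤ δ → f i j ≤ a * ((τ j - τ i) ^ α) ^ q)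
    (hsplit : ∀ i m j, i < m → m < j → j ≤ N →
      f i j ≤ f i m + f m j + b * ((τ j - τ i) ^ α) ^ q)
    (hkl : k < l) (hl : l ≤ N) : f k l ≤ 2 / δ * (a + b) * ((τ l - τ k) ^ α) ^ q := by
  have hmono := hτ.strictMono
  have hω {i j i' j' : ℕ} (hi : i' ≤ i) (hij : i < j) (hj : j ≤ j') :
      ((τ j - τ i) ^ α) ^ q ≤ ((τ j' - τ i') ^ α) ^ q := by
    have hpos := sub_pos.mpr (hmono hij)
    have hle := sub_le_sub (hmono.monotone hj) (hmono.monotone hi)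
    gcongr
  have hω₀ {i j : ℕ} (hij : i < j) : 0 ≤ ((τ j - τ i) ^ α) ^ q :=
    pow_nonneg (Real.rpow_nonneg (sub_pos.mpr (hmono hij)).le α) q
  have hprepend (p i m : ℕ) (him : i < m) (hml : m < l) (hle : τ m - τ i ≤ δ)
      (hp : f m l ≤ p * ((a + b) * ((τ l - τ m) ^ α) ^ q)) :
      f i l ≤ (p + 1 : ℕ) * ((a + b) * ((τ l - τ i) ^ α) ^ q) := by
    calc f i l ≤ a * ((τ m - τ i) ^ α) ^ q + p * ((a + b) * ((τ l - τ m) ^ α) ^ q)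
          + b * ((τ l - τ i) ^ α) ^ q := by
          linarith [hsplit i m l him hml hl, hlocal i m him (hml.le.trans hl) hle]
      _ ≤ a * ((τ l - τ i) ^ α) ^ q + p * ((a + b) * ((τ l - τ i) ^ α) ^ q)
          + b * ((τ l - τ i) ^ α) ^ q := by
          gcongr ?_ * ?_ + ?_ * (?_ * ?_) + _
          · exact hω le_rfl him hml.le
          · exact hω him.le hml le_rfl
      _ = _ := by
          push_cast
          ring
  obtain ⟨p, hp, hle⟩ := hτ.exists_patching hδ hδ'
    (P := fun p i => f i l ≤ p * ((a + b) * ((τ l - τ i) ^ α) ^ q))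
    (fun i hil hle => (hlocal i l hil hl hle).trans
      (by push_cast; linarith [mul_nonneg hb (hω₀ hil)])) hprepend hkl hl
  rw [mul_assoc]
  exact hle.trans (mul_le_mul_of_nonneg_right hp (mul_nonneg (add_nonneg ha hb) (hω₀ hkl)))

end UniformGrid

/-- The range of the exponent `α` and of the bounds `M`, `K`, `L` in which the explicit constants
are meaningful. -/
structure AdmissibleConstants (α M K L : ℝ) : Prop where
  exponent_mem : α ∈ Set.Ioc (1 / 3 : ℝ) (1 / 2)
  bound_nonneg : 0 ≤ M
  path_nonneg : 0 ≤ K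
  area_nonneg : 0 ≤ L

theorem rpow_le_inv_of_le_rpow_neg {c x : ℝ} (hα : 0 < α) (hc : 0 < c) (hx : 0 ≤ x)
    (h : x ≤ c ^ (-(1 / α))) : x ^ α ≤ c⁻¹ := by
  refine (Real.rpow_le_rpow hx h hα.le).trans_eq ?_
  rw [← Real.rpow_mul hc.le, neg_mul, one_div_mul_cancel hα.ne', Real.rpow_neg_one]

theorem rpow_neg_one_div_le_half {c : ℝ} (hα₀ : 0 < α) (hα₁ : α ≤ 1) (hc : 2 ≤ c) :
    c ^ (-(1 / α)) ≤ 1 / 2 := by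
  have hexp : (1 : ℝ) ≤ 1 / α := (one_le_div hα₀).mpr hα₁
  calc c ^ (-(1 / α)) ≤ c ^ (-1 : ℝ) :=
        Real.rpow_le_rpow_of_exponent_le (by linarith) (by linarith)
    _ = 1 / c := by rw [Real.rpow_neg_one, one_div]
    _ ≤ 1 / 2 := one_div_le_one_div_of_le two_pos hc

namespace AdmissibleConstants

variable (hc : AdmissibleConstants α M K L) (d d')
include hc

theorem exponent_pos : 0 < α := by linarith [hc.exponent_mem.1]

theorem ratio_pos : (0 : ℝ) < 1 - 2 ^ (1 - 3 * α) :=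
  sub_pos.mpr (Real.rpow_lt_one_of_one_lt_of_neg one_lt_two (by linarith [hc.exponent_mem.1]))

theorem two_mul_eq_ratio_mul (κ : ℝ) :
    2 * κ = (1 - 2 ^ (1 - 3 * α)) * (2 / (1 - 2 ^ (1 - 3 * α)) * κ) := by
  have := hc.ratio_pos.ne'
  field_simp

theorem kappa_nonneg {c₁ c₂ : ℝ} (h₁ : 0 ≤ c₁) (h₂ : 0 ≤ c₂) : 0 ≤ kappa d d' M K L c₁ c₂ := by
  obtain ⟨-, hM, hK, hL⟩ := hc
  unfold kappa
  positivity

theorem locC1_pos : 0 < locC1 d d' M K L := by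
  obtain ⟨-, hM, hK, hL⟩ := hc
  unfold locC1
  positivity

theorem locC2_pos : 0 < locC2 d d' M L := by
  have := hc.area_nonneg
  unfold locC2
  positivity

theorem kappa_loc_nonneg : 0 ≤ kappa d d' M K L (locC1 d d' M K L) (locC2 d d' M L) :=
  hc.kappa_nonneg d d' (hc.locC1_pos d d').le (hc.locC2_pos d d').le

theorem locC3_nonneg : 0 ≤ locC3 d d' α M K L :=
  mul_nonneg (div_nonneg zero_le_two hc.ratio_pos.le) (hc.kappa_loc_nonneg d d')

theorem inv_two_add_locC3_pos : 0 < (2 + locC3 d d' α M K L)⁻¹ :=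
  inv_pos.mpr (by linarith [hc.locC3_nonneg d d'])

theorem delta_pos : 0 < delta d d' α M K L :=
  Real.rpow_pos_of_pos (by linarith [hc.locC3_nonneg d d']) _

theorem delta_le_half : delta d d' α M K L ≤ 1 / 2 :=
  rpow_neg_one_div_le_half hc.exponent_pos (by linarith [hc.exponent_mem.2])
    (by linarith [hc.locC3_nonneg d d'])

theorem constC1_pos : 0 < constC1 d d' α M K L :=
  mul_pos (div_pos two_pos (hc.delta_pos d d')) (hc.locC1_pos d d')

theorem constC2_pos : 0 < constC2 d d' α M K L := by
  have hδ := hc.delta_pos d d'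
  have hC₁ := hc.constC1_pos d d'
  have hC₂ := hc.locC2_pos d d'
  obtain ⟨-, hM, hK, -⟩ := hc
  unfold constC2
  positivity

theorem kappa_const_nonneg :
    0 ≤ kappa d d' M K L (constC1 d d' α M K L) (constC2 d d' α M K L) :=
  hc.kappa_nonneg d d' (hc.constC1_pos d d').le (hc.constC2_pos d d').le

theorem constC3_nonneg : 0 ≤ constC3 d d' α M K L :=
  mul_nonneg (div_nonneg zero_le_two hc.ratio_pos.le) (hc.kappa_const_nonneg d d')

theorem locB1_pos : 0 < locB1 d d' M K L := by
  obtain ⟨-, hM, hK, hL⟩ := hc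
  unfold locB1
  positivity

theorem locB2_nonneg : 0 ≤ locB2 d d' M L := by
  obtain ⟨-, hM, -, hL⟩ := hc
  unfold locB2
  positivity

open RoughEquation in
theorem diffKappa_nonneg : 0 ≤ diffKappa d d' M K L (constC1 d d' α M K L) (constC2 d d' α M K L)
    (locB1 d d' M K L) (locB2 d d' M L) := by
  have hC₁ := hc.constC1_pos d d'
  have hC₂ := hc.constC2_pos d d'
  have hB₁ := hc.locB1_pos d d'
  have hB₂ := hc.locB2_nonneg d d'
  obtain ⟨-, hM, hK, hL⟩ := hc
  unfold diffKappa
  positivity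

theorem locB3_nonneg : 0 ≤ locB3 d d' α M K L :=
  mul_nonneg (div_nonneg zero_le_two hc.ratio_pos.le) (hc.diffKappa_nonneg d d')

theorem two_le_delta'_base : 2 ≤ 2 + 2 * locB1 d d' M K L + locB3 d d' α M K L := by
  linarith [hc.locB1_pos d d', hc.locB3_nonneg d d']

theorem delta'_pos : 0 < delta' d d' α M K L :=
  Real.rpow_pos_of_pos (by linarith [hc.two_le_delta'_base d d']) _

theorem delta'_le_half : delta' d d' α M K L ≤ 1 / 2 :=
  rpow_neg_one_div_le_half hc.exponent_pos (by linarith [hc.exponent_mem.2])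
    (hc.two_le_delta'_base d d')

theorem constB_ge : 2 + 2 ^ (2 / delta' d d' α M K L) ≤ constB d d' α M K L := by
  have hpow : (0 : ℝ) < 2 ^ (2 / delta' d d' α M K L) := Real.rpow_pos_of_pos two_pos _
  have := mul_le_mul_of_nonneg_right (hc.two_le_delta'_base d d') (by linarith :
    0 ≤ 1 + (2 : ℝ) ^ (2 / delta' d d' α M K L))
  unfold constB
  linarith

theorem constG1_nonneg : 0 ≤ constG1 d d' α M K L := by
  have hpow : (0 : ℝ) < 2 ^ (2 / delta' d d' α M K L) := Real.rpow_pos_of_pos two_pos _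
  exact mul_nonneg (by linarith [hc.constB_ge d d']) (hc.constC3_nonneg d d')

end AdmissibleConstants

namespace RoughEquation

variable {R : RoughEquation E d'}

theorem IsRegular.admissible (hR : R.IsRegular d α M K L) : AdmissibleConstants α M K L :=
  ⟨hR.exponent_mem, hR.bound_nonneg, hR.path_nonneg, hR.area_nonneg⟩

/-- A sequence of states along a grid which follows the second-order increments up to an error of
`ε` per unit of time: the trajectories of the scheme (`ε = 0`) and the samples of a solution. -/
structure IsApproxTrajectory (R : RoughEquation E d') (h ε : ℝ) (N : ℕ) (τ : ℕ → ℝ) (y : ℕ → E) :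
    Prop extends UniformGrid h N τ where
  norm_remainder_le : ∀ k < N, ‖R.remainder (τ k) (τ (k + 1)) (y k) (y (k + 1))‖ ≤ ε * h

namespace IsApproxTrajectory

variable {h ε S : ℝ} {N k l : ℕ} {τ : ℕ → ℝ} {y y' : ℕ → E}

theorem shift (hy : R.IsApproxTrajectory h ε N τ y) {m N' : ℕ} (h' : m + N' ≤ N) :
    R.IsApproxTrajectory h ε N' (fun k => τ (m + k)) fun k => y (m + k) where
  toUniformGrid := hy.toUniformGrid.shift h'
  norm_remainder_le k hk := hy.norm_remainder_le (m + k) (by omega)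

section Remainder

variable (hR : R.IsRegular d α M K L) (hy : R.IsApproxTrajectory h ε N τ y)
  (hε : ε ≤ (2 + locC3 d d' α M K L)⁻¹)
include hR hy hε

theorem remainder_bound_le_rpow_sq (hδ : τ N - τ 0 ≤ delta d d' α M K L) (hkl : k < l)
    (hl : l ≤ N) : locC3 d d' α M K L * ((τ l - τ k) ^ α) ^ 3 + ε * (τ l - τ k) ≤
      ((τ l - τ k) ^ α) ^ 2 := by
  have hmono := hy.strictMono
  have hnonneg : 0 ≤ τ l - τ k := (sub_pos.mpr (hmono hkl)).le
  have hC := hR.admissible.locC3_nonneg d d'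
  have hω : (τ l - τ k) ^ α ≤ (2 + locC3 d d' α M K L)⁻¹ :=
    rpow_le_inv_of_le_rpow_neg hR.exponent_pos (by linarith) hnonneg
      (by rw [← delta]; linarith [hmono.monotone hl, hmono.monotone k.zero_le])
  have hsq := hR.sub_le_rpow_sq (hy.nonneg_apply k) (hmono hkl).le (hy.apply_le_one hl)
  have hinv : (1 + locC3 d d' α M K L) * (2 + locC3 d d' α M K L)⁻¹ ≤ 1 := by
    rw [mul_inv_le_iff₀ (by linarith)]
    linarith
  have hpos := hR.admissible.inv_two_add_locC3_pos d d'
  set C := locC3 d d' α M K L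
  set ω := (τ l - τ k) ^ α
  calc C * ω ^ 3 + ε * (τ l - τ k) = C * ω ^ 2 * ω + ε * (τ l - τ k) := by ring
    _ ≤ C * ω ^ 2 * (2 + C)⁻¹ + (2 + C)⁻¹ * ω ^ 2 := by gcongr
    _ = (1 + C) * (2 + C)⁻¹ * ω ^ 2 := by ring
    _ ≤ ω ^ 2 := mul_le_of_le_one_left (sq_nonneg ω) hinv

theorem norm_remainder_le_of_length_le (hδ : τ N - τ 0 ≤ delta d d' α M K L) (hkl : k < l)
    (hl : l ≤ N) : ‖R.remainder (τ k) (τ l) (y k) (y l)‖ ≤ ((τ l - τ k) ^ α) ^ 2 := by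
  have hc := hR.admissible
  refine (hy.toUniformGrid.sewing (e := fun i j => ‖R.remainder (τ i) (τ j) (y i) (y j)‖)
    hc.exponent_pos.le (hc.locC3_nonneg d d') (hc.kappa_loc_nonneg d d')
    (hc.two_mul_eq_ratio_mul _).le hy.norm_remainder_le (fun i m j him hmj hj hle => ?_)
    hkl hl).trans (hy.remainder_bound_le_rpow_sq hR hε hδ hkl hl)
  have hmono := hy.strictMono
  have hi := hy.nonneg_apply i
  have hm := hy.apply_le_one (hmj.le.trans hj)
  have hrem := hle.trans (hy.remainder_bound_le_rpow_sq hR hε hδ him (hmj.le.trans hj))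
  have hω : (τ m - τ i) ^ α ≤ (τ j - τ i) ^ α := Real.rpow_le_rpow
    (sub_pos.mpr (hmono him)).le (by linarith [hmono hmj]) hc.exponent_pos.le
  have hω₀ : 0 ≤ (τ m - τ i) ^ α := Real.rpow_nonneg (sub_pos.mpr (hmono him)).le α
  have hC₁ := hc.locC1_pos d d'
  have hC₂ := hc.locC2_pos d d'
  exact hR.norm_remainder_three_point_le hi (hmono him) (hmono hmj) (hy.apply_le_one hj) _
    ((hR.norm_sub_le_of_remainder_le hi (hmono him) hm hrem).trans (by gcongr))
    ((hR.norm_firstRemainder_le hi (hmono him) hm hrem).trans (by gcongr))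

theorem norm_remainder_le_of_sub_le (hkl : k < l) (hl : l ≤ N)
    (hδ : τ l - τ k ≤ delta d d' α M K L) :
    ‖R.remainder (τ k) (τ l) (y k) (y l)‖ ≤ ((τ l - τ k) ^ α) ^ 2 := by
  obtain ⟨n, rfl⟩ := Nat.exists_eq_add_of_le hkl.le
  exact (hy.shift hl).norm_remainder_le_of_length_le (k := 0) hR hε hδ (by omega) le_rfl

theorem norm_sub_le (hh : 3 * h ≤ delta d d' α M K L) (hkl : k < l) (hl : l ≤ N) :
    ‖y l - y k‖ ≤ constC1 d d' α M K L * (τ l - τ k) ^ α := by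
  have hc := hR.admissible
  rw [constC1, ← pow_one ((τ l - τ k) ^ α), ← add_zero (locC1 d d' M K L)]
  refine hy.le_two_div_mul (f := fun i j => ‖y j - y i‖) hh (hc.delta_le_half d d')
    hc.exponent_pos.le (hc.locC1_pos d d').le le_rfl (fun i j hij hj hle => ?_)
    (fun i m j _ _ _ => ?_) hkl hl
  · rw [pow_one]
    exact hR.norm_sub_le_of_remainder_le (hy.nonneg_apply i) (hy.strictMono hij)
      (hy.apply_le_one hj) (hy.norm_remainder_le_of_sub_le hR hε hij hj hle)
  · rw [zero_mul, add_zero, add_comm]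
    exact norm_sub_le_norm_sub_add_norm_sub _ _ _

theorem norm_sub_le_of_lt_of_le (hh : 3 * h ≤ delta d d' α M K L) {m : ℕ} (hkm : k < m)
    (hml : m ≤ l) (hl : l ≤ N) :
    ‖y m - y k‖ ≤ constC1 d d' α M K L * (τ l - τ k) ^ α := by
  have hmono := hy.strictMono
  exact (hy.norm_sub_le hR hε hh hkm (hml.trans hl)).trans (mul_le_mul_of_nonneg_left
    (Real.rpow_le_rpow (sub_pos.mpr (hmono hkm)).le (by linarith [hmono.monotone hml])
      hR.exponent_pos.le) (hR.admissible.constC1_pos d d').le)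

theorem norm_firstRemainder_le (hh : 3 * h ≤ delta d d' α M K L) (hkl : k < l) (hl : l ≤ N) :
    ‖R.firstRemainder (τ k) (τ l) (y k) (y l)‖ ≤
      constC2 d d' α M K L * ((τ l - τ k) ^ α) ^ 2 := by
  have hc := hR.admissible
  have hM := hc.bound_nonneg
  have hK := hc.path_nonneg
  have hC₁ := hc.constC1_pos d d'
  have hmono := hy.strictMono
  refine (hy.le_two_div_mul (f := fun i j => ‖R.firstRemainder (τ i) (τ j) (y i) (y j)‖) hh
    (hc.delta_le_half d d') hc.exponent_pos.le (hc.locC2_pos d d').le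
    (b := d * M * constC1 d d' α M K L + d * d' * M * K * constC1 d d' α M K L) (by positivity)
    (fun i j hij hj hle => hR.norm_firstRemainder_le (hy.nonneg_apply i) (hmono hij)
      (hy.apply_le_one hj) (hy.norm_remainder_le_of_sub_le hR hε hij hj hle))
    (fun i m j him hmj hj => hR.norm_firstRemainder_three_point_le (hy.nonneg_apply i) (hmono him)
      (hmono hmj) (hy.apply_le_one hj) _ hC₁.le
      (hy.norm_sub_le_of_lt_of_le hR hε hh him hmj.le hj)) hkl hl).trans_eq ?_
  unfold constC2
  ring

theorem norm_firstRemainder_le_of_lt_of_le (hh : 3 * h ≤ delta d d' α M K L) {m : ℕ} (hkm : k < m)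
    (hml : m ≤ l) (hl : l ≤ N) : ‖R.firstRemainder (τ k) (τ m) (y k) (y m)‖ ≤
      constC2 d d' α M K L * ((τ l - τ k) ^ α) ^ 2 := by
  have hmono := hy.strictMono
  have hω₀ : 0 ≤ (τ m - τ k) ^ α := Real.rpow_nonneg (sub_pos.mpr (hmono hkm)).le α
  have hω : (τ m - τ k) ^ α ≤ (τ l - τ k) ^ α := Real.rpow_le_rpow (sub_pos.mpr (hmono hkm)).le
    (by linarith [hmono.monotone hml]) hR.exponent_pos.le
  have hC := hR.admissible.constC2_pos d d'
  exact (hy.norm_firstRemainder_le hR hε hh hkm (hml.trans hl)).trans (by gcongr)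

theorem norm_remainder_le_add (hh : 3 * h ≤ delta d d' α M K L) (hkl : k < l) (hl : l ≤ N) :
    ‖R.remainder (τ k) (τ l) (y k) (y l)‖ ≤
      constC3 d d' α M K L * ((τ l - τ k) ^ α) ^ 3 + ε * (τ l - τ k) := by
  have hc := hR.admissible
  have hmono := hy.strictMono
  exact hy.toUniformGrid.sewing (e := fun i j => ‖R.remainder (τ i) (τ j) (y i) (y j)‖)
    hc.exponent_pos.le (hc.constC3_nonneg d d') (hc.kappa_const_nonneg d d')
    (hc.two_mul_eq_ratio_mul _).le hy.norm_remainder_le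
    (fun i m j him hmj hj _ => hR.norm_remainder_three_point_le (hy.nonneg_apply i) (hmono him)
      (hmono hmj) (hy.apply_le_one hj) _ (hy.norm_sub_le_of_lt_of_le hR hε hh him hmj.le hj)
      (hy.norm_firstRemainder_le_of_lt_of_le hR hε hh him hmj.le hj)) hkl hl

end Remainder

section Stability

variable (hR : R.IsRegular d α M K L) (hy : R.IsApproxTrajectory h 0 N τ y)
  (hy' : R.IsApproxTrajectory h 0 N τ y')
include hR hy

theorem rpow_le_inv_of_length_le (hδ : τ N - τ 0 ≤ delta' d d' α M K L) (hkl : k < l)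
    (hl : l ≤ N) :
    (τ l - τ k) ^ α ≤ (2 + 2 * locB1 d d' M K L + locB3 d d' α M K L)⁻¹ := by
  have hmono := hy.strictMono
  refine rpow_le_inv_of_le_rpow_neg hR.exponent_pos
    (by linarith [hR.admissible.two_le_delta'_base d d']) (sub_pos.mpr (hmono hkl)).le ?_
  rw [← delta']
  linarith [hmono.monotone hl, hmono.monotone k.zero_le]

theorem diffRemainder_bound_le_rpow_sq (hδ : τ N - τ 0 ≤ delta' d d' α M K L) (hS : 0 ≤ S)
    (hkl : k < l) (hl : l ≤ N) :
    locB3 d d' α M K L * S * ((τ l - τ k) ^ α) ^ 3 + d * M * S * (τ l - τ k) ≤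
      (1 + d * M) * S * ((τ l - τ k) ^ α) ^ 2 := by
  have hc := hR.admissible
  have hM := hc.bound_nonneg
  have hB₁ := hc.locB1_pos d d'
  have hB₃ := hc.locB3_nonneg d d'
  have hsq := hR.sub_le_rpow_sq (hy.nonneg_apply k) (hy.strictMono hkl).le (hy.apply_le_one hl)
  have hω := hy.rpow_le_inv_of_length_le hR hδ hkl hl
  set ω := (τ l - τ k) ^ α
  have hBω : locB3 d d' α M K L * ω ≤ 1 := by
    refine (mul_le_mul_of_nonneg_left hω hB₃).trans ?_
    rw [mul_inv_le_iff₀ (by linarith)]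
    linarith
  calc _ = locB3 d d' α M K L * ω * (S * ω ^ 2) + d * M * S * (τ l - τ k) := by ring
    _ ≤ 1 * (S * ω ^ 2) + d * M * S * ω ^ 2 := by gcongr
    _ = _ := by ring

include hy'

theorem norm_diffRemainder_succ_le (hk : k < N) (hS : ‖y k - y' k‖ ≤ S) :
    ‖R.diffRemainder (τ k) (τ (k + 1)) (y k) (y (k + 1)) (y' k) (y' (k + 1))‖ ≤
      d * M * S * h := by
  have : 0 ≤ M := hR.bound_nonneg
  have hrem : R.remainder (τ k) (τ (k + 1)) (y k) (y (k + 1)) = 0 :=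
    norm_le_zero_iff.mp (by simpa only [zero_mul] using hy.norm_remainder_le k hk)
  have hrem' : R.remainder (τ k) (τ (k + 1)) (y' k) (y' (k + 1)) = 0 :=
    norm_le_zero_iff.mp (by simpa only [zero_mul] using hy'.norm_remainder_le k hk)
  have hdrift : R.diffRemainder (τ k) (τ (k + 1)) (y k) (y (k + 1)) (y' k) (y' (k + 1)) =
      h • (R.drift (y k) - R.drift (y' k)) := by
    rw [← sub_zero (R.diffRemainder _ _ _ _ _ _), ← sub_zero (0 : E)]
    nth_rw 1 [← hrem]
    rw [← hrem']
    unfold diffRemainder remainder increment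
    rw [hy.succ_sub]
    module
  rw [hdrift, norm_smul, Real.norm_of_nonneg hy.pos.le, mul_comm]
  exact mul_le_mul_of_nonneg_right ((hR.drift.norm_sub_le _ _).trans (by gcongr)) hy.pos.le

variable (hh : 3 * h ≤ delta d d' α M K L) (hδ : τ N - τ 0 ≤ delta' d d' α M K L)
include hh hδ

theorem norm_diffRemainder_le (hS : ∀ k ≤ N, ‖y k - y' k‖ ≤ S) (hkl : k < l) (hl : l ≤ N) :
    ‖R.diffRemainder (τ k) (τ l) (y k) (y l) (y' k) (y' l)‖ ≤
      (1 + d * M) * S * ((τ l - τ k) ^ α) ^ 2 := by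
  have hc := hR.admissible
  have hmono := hy.strictMono
  have hε := (hc.inv_two_add_locC3_pos d d').le
  have hS₀ : 0 ≤ S := (norm_nonneg _).trans (hS 0 N.zero_le)
  refine (hy.toUniformGrid.sewing
    (e := fun i j => ‖R.diffRemainder (τ i) (τ j) (y i) (y j) (y' i) (y' j)‖) hc.exponent_pos.le
    (mul_nonneg (hc.locB3_nonneg d d') hS₀) (mul_nonneg (hc.diffKappa_nonneg d d') hS₀) ?_
    (fun i hi => hy.norm_diffRemainder_succ_le hR hy' hi (hS i hi.le))
    (fun i m j him hmj hj hle => ?_) hkl hl).trans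
      (hy.diffRemainder_bound_le_rpow_sq hR hδ hS₀ hkl hl)
  · rw [← mul_assoc, ← mul_assoc, hc.two_mul_eq_ratio_mul]
    rfl
  have hi := hy.nonneg_apply i
  have hm := hmj.le.trans hj
  have hrem := hle.trans (hy.diffRemainder_bound_le_rpow_sq hR hδ hS₀ him hm)
  have hω : (τ m - τ i) ^ α ≤ (τ j - τ i) ^ α := Real.rpow_le_rpow
    (sub_pos.mpr (hmono him)).le (by linarith [hmono hmj]) hc.exponent_pos.le
  have hω₀ : 0 ≤ (τ m - τ i) ^ α := Real.rpow_nonneg (sub_pos.mpr (hmono him)).le α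
  have hB₁ := hc.locB1_pos d d'
  have hB₂ := hc.locB2_nonneg d d'
  rw [diffRemainder_eq_add _ (τ m) _ _ (y m) _ _ (y' m)]
  exact norm_add_le_of_le (norm_add_le _ _) (hR.norm_noise_three_point_sub_le hi (hmono him)
    (hmono hmj) (hy.apply_le_one hj) (hS i (him.le.trans hm)) (hS m hm)
    (hy.norm_sub_le_of_lt_of_le hR hε hh him hmj.le hj)
    (hy'.norm_sub_le_of_lt_of_le hR hε hh him hmj.le hj)
    (hy'.norm_firstRemainder_le_of_lt_of_le hR hε hh him hmj.le hj)
    ((hR.norm_sub_sub_le hi (hmono him) (hy.apply_le_one hm) (hS i (him.le.trans hm)) hrem).trans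
      (by gcongr))
    ((hR.norm_sub_sub_linearTerm_le hi (hmono him) (hy.apply_le_one hm) (hS i (him.le.trans hm))
      hrem).trans (by gcongr)))

theorem norm_sub_le_two_mul : ‖y N - y' N‖ ≤ 2 * ‖y 0 - y' 0‖ := by
  obtain ⟨m, hm, hmax⟩ := Finset.exists_max_image (Finset.Iic N) (fun i => ‖y i - y' i‖)
    ⟨0, Finset.mem_Iic.mpr N.zero_le⟩
  simp only [Finset.mem_Iic] at hm hmax
  rcases m.eq_zero_or_pos with rfl | hm₀
  · linarith [hmax N le_rfl, norm_nonneg (y 0 - y' 0)]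
  have hc := hR.admissible
  have hB₁ := hc.locB1_pos d d'
  have hstep := hR.norm_sub_sub_le (hy.nonneg_apply 0) (hy.strictMono hm₀) (hy.apply_le_one hm)
    (hmax 0 N.zero_le) (hy.norm_diffRemainder_le hR hy' hh hδ hmax hm₀ hm)
  have hhalf : locB1 d d' M K L * (τ m - τ 0) ^ α ≤ 1 / 2 := by
    refine (mul_le_mul_of_nonneg_left (hy.rpow_le_inv_of_length_le hR hδ hm₀ hm) hB₁.le).trans ?_
    rw [mul_inv_le_iff₀ (by linarith [hc.two_le_delta'_base d d'])]
    linarith [hc.locB3_nonneg d d']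
  have hprod := mul_le_mul_of_nonneg_right hhalf (norm_nonneg (y m - y' m))
  linarith [hmax N le_rfl, norm_le_norm_add_norm_sub' (y m - y' m) (y 0 - y' 0)]

omit hδ in
theorem norm_sub_le_rpow_mul (hh' : 3 * h ≤ delta' d d' α M K L) (hl : l ≤ N) :
    ‖y l - y' l‖ ≤ 2 ^ (2 / delta' d d' α M K L) * ‖y 0 - y' 0‖ := by
  have hc := hR.admissible
  have hwindow (i j : ℕ) (hij : i < j) (hj : j ≤ N) (hle : τ j - τ i ≤ delta' d d' α M K L) :
      ‖y j - y' j‖ ≤ 2 * ‖y i - y' i‖ := by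
    obtain ⟨n, rfl⟩ := Nat.exists_eq_add_of_le hij.le
    exact (hy.shift hj).norm_sub_le_two_mul hR (hy'.shift hj) hh hle
  rcases l.eq_zero_or_pos with rfl | hl₀
  · exact le_mul_of_one_le_left (norm_nonneg _)
      (Real.one_le_rpow one_le_two (div_pos two_pos (hc.delta'_pos d d')).le)
  obtain ⟨p, hp, hle⟩ := hy.exists_patching hh' (hc.delta'_le_half d d')
    (P := fun p i => ‖y l - y' l‖ ≤ 2 ^ p * ‖y i - y' i‖)
    (fun i hil hle => by simpa only [pow_one] using hwindow i l hil hl hle)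
    (fun p i m him hml hle hp => hp.trans <| by
      rw [pow_succ, mul_assoc]
      exact mul_le_mul_of_nonneg_left (hwindow i m him (hml.le.trans hl) hle) (by positivity))
    hl₀ hl
  refine hle.trans (mul_le_mul_of_nonneg_right ?_ (norm_nonneg _))
  rw [← Real.rpow_natCast]
  exact Real.rpow_le_rpow_of_exponent_le one_le_two hp

end Stability
end IsApproxTrajectory
end RoughEquation

theorem uniformGrid_add_mul {h s : ℝ} {N : ℕ} (hh : 0 < h) (hs : 0 ≤ s) (hN : s + N * h ≤ 1) :
    UniformGrid h N fun k => s + k * h where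
  pos := hh
  nonneg := by simpa only [Nat.cast_zero, zero_mul, add_zero] using hs
  sub_eq k l := by ring
  le_one := hN

theorem mesh_pos (n : ℕ) : 0 < mesh n := by
  unfold mesh
  positivity

theorem mesh_le_one (n : ℕ) : mesh n ≤ 1 :=
  (div_le_one (by positivity)).mpr (one_le_pow₀ one_le_two)

theorem two_pow_mul_mesh (n : ℕ) : 2 ^ n * mesh n = 1 :=
  mul_one_div_cancel (pow_ne_zero n two_ne_zero)

theorem gridPoint_eq_mul_mesh (n k : ℕ) : gridPoint n k = k * mesh n :=
  (mul_one_div _ _).symm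

theorem gridPoint_nonneg (n k : ℕ) : 0 ≤ gridPoint n k :=
  div_nonneg k.cast_nonneg (by positivity)

theorem uniformGrid_gridPoint {n k : ℕ} (hk : k ≤ 2 ^ n) :
    UniformGrid (mesh n) k (gridPoint n) := by
  have hle : 0 + (k : ℝ) * mesh n ≤ 1 := by
    rw [zero_add, ← two_pow_mul_mesh n]
    exact mul_le_mul_of_nonneg_right (mod_cast hk) (mesh_pos n).le
  convert uniformGrid_add_mul (mesh_pos n) le_rfl hle using 2 with j
  rw [zero_add, gridPoint_eq_mul_mesh]

theorem floor_two_pow_mul_le {t : ℝ} (ht : t ≤ 1) (n : ℕ) : ⌊2 ^ n * t⌋₊ ≤ 2 ^ n :=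
  Nat.floor_le_of_le (by
    push_cast
    exact mul_le_of_le_one_right (by positivity) ht)

theorem gridPoint_floor_le {t : ℝ} (ht : 0 ≤ t) (n : ℕ) : gridPoint n ⌊2 ^ n * t⌋₊ ≤ t := by
  rw [gridPoint, div_le_iff₀' (by positivity)]
  exact Nat.floor_le (by positivity)

theorem sub_gridPoint_floor_le (n : ℕ) (t : ℝ) : t - gridPoint n ⌊2 ^ n * t⌋₊ ≤ mesh n := by
  rw [gridPoint, mesh, sub_le_iff_le_add, ← add_div, le_div_iff₀' (by positivity), add_comm]
  exact (Nat.lt_floor_add_one _).le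

theorem two_pow_mul_mesh_rpow_cube (n : ℕ) (α : ℝ) :
    2 ^ n * (mesh n ^ α) ^ 3 = mesh n ^ (3 * α - 1) := by
  have hmesh := mesh_pos n
  rw [Real.rpow_sub hmesh, Real.rpow_one, mul_comm 3 α, Real.rpow_mul hmesh.le,
    eq_div_iff hmesh.ne', mul_right_comm, two_pow_mul_mesh, one_mul]
  norm_cast

theorem eventually_mul_mesh_le (c : ℝ) {b : ℝ} (hb : 0 < b) :
    ∀ᶠ n in Filter.atTop, c * mesh n ≤ b := by
  have hlim : Filter.Tendsto (fun n => c * mesh n) Filter.atTop (nhds 0) := by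
    simpa only [mesh, one_div_pow, mul_zero] using
      (tendsto_pow_atTop_nhds_zero_of_lt_one (by norm_num : (0 : ℝ) ≤ 1 / 2)
        (by norm_num)).const_mul c
  exact (hlim.eventually_lt_const hb).mono fun n hn => hn.le

namespace RoughEquation

variable {R : RoughEquation E d'}

/-- The states of the Milstein scheme along the times `τ`, started from `x`. -/
noncomputable def trajectory (R : RoughEquation E d') (τ : ℕ → ℝ) (x : E) : ℕ → E
  | 0 => x
  | k + 1 => R.trajectory τ x k + R.increment (τ k) (τ (k + 1)) (R.trajectory τ x k)

theorem isApproxTrajectory_trajectory {h : ℝ} {N : ℕ} {τ : ℕ → ℝ} (hτ : UniformGrid h N τ)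
    (x : E) : R.IsApproxTrajectory h 0 N τ (R.trajectory τ x) where
  toUniformGrid := hτ
  norm_remainder_le k _ := by simp [trajectory, remainder]

theorem trajectory_succ (τ : ℕ → ℝ) (x : E) (k : ℕ) : R.trajectory τ x (k + 1) =
    R.trajectory (fun j => τ (1 + j)) (x + R.increment (τ 0) (τ 1) x) k := by
  induction k with
  | zero => rfl
  | succ k ih => rw [trajectory, ih, trajectory, Nat.add_comm 1 k, Nat.add_comm 1 (k + 1)]

section Flow

variable (hR : R.IsRegular d α M K L) {h : ℝ} {N : ℕ} {τ : ℕ → ℝ} (hτ : UniformGrid h N τ)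
  (hh : 3 * h ≤ delta d d' α M K L) (hh' : 3 * h ≤ delta' d d' α M K L)
include hR hτ hh hh'

theorem IsRegular.norm_trajectory_sub_trajectory_le (x x' : E) :
    ‖R.trajectory τ x N - R.trajectory τ x' N‖ ≤ 2 ^ (2 / delta' d d' α M K L) * ‖x - x'‖ :=
  (isApproxTrajectory_trajectory hτ x).norm_sub_le_rpow_mul hR
    (isApproxTrajectory_trajectory hτ x') hh hh' le_rfl

theorem IsRegular.norm_trajectory_sub_le {y : ℕ → E} {η : ℝ}
    (hy : ∀ k < N, ‖R.remainder (τ k) (τ (k + 1)) (y k) (y (k + 1))‖ ≤ η) :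
    ‖R.trajectory τ (y 0) N - y N‖ ≤ N * (2 ^ (2 / delta' d d' α M K L) * η) := by
  induction N generalizing τ y with
  | zero => simp [trajectory]
  | succ N ih =>
    have hshift : UniformGrid h N fun k => τ (1 + k) := hτ.shift (Nat.add_comm 1 N).le
    have htail := ih hshift (y := fun k => y (1 + k)) fun k hk => hy (1 + k) (by omega)
    have hstep : ‖y 0 + R.increment (τ 0) (τ 1) (y 0) - y 1‖ ≤ η := by
      rw [norm_sub_rev, ← sub_sub]
      exact hy 0 N.succ_pos
    rw [trajectory_succ, Nat.add_comm N 1]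
    calc _ ≤ 2 ^ (2 / delta' d d' α M K L) * η + N * (2 ^ (2 / delta' d d' α M K L) * η) :=
          (norm_sub_le_norm_sub_add_norm_sub _ _ _).trans (add_le_add
            ((hR.norm_trajectory_sub_trajectory_le hshift hh hh' _ (y 1)).trans
              (mul_le_mul_of_nonneg_left hstep (by positivity))) htail)
      _ = _ := by
          push_cast
          ring

end Flow

/-- `X` solves the equation on `[0, 1]` in the sense of Davie: over `[s, t]` it follows the
second-order increment up to `o(t - s)`, uniformly in `0 ≤ s < t ≤ 1`. -/
def IsDavieSolution (R : RoughEquation E d') (X : ℝ → E) : Prop :=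
  ∀ ε > 0, ∃ η > 0, ∀ s t : ℝ, 0 ≤ s → s < t → t ≤ 1 → t - s < η →
    ‖R.remainder s t (X s) (X t)‖ ≤ ε * (t - s)

namespace IsDavieSolution

variable {X : ℝ → E} {s t : ℝ}

theorem exists_isApproxTrajectory (hX : R.IsDavieSolution X) {ε b : ℝ} (hε : 0 < ε) (hb : 0 < b)
    (hs : 0 ≤ s) (hst : s < t) (ht : t ≤ 1) : ∃ (N : ℕ) (h : ℝ), 0 < N ∧ h ≤ b ∧ s + N * h = t ∧
      R.IsApproxTrajectory h ε N (fun k => s + k * h) (fun k => X (s + k * h)) := by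
  obtain ⟨η, hη, hexp⟩ := hX ε hε
  obtain ⟨N, hN⟩ := exists_nat_gt ((t - s) / min η b)
  have hN₀ : (0 : ℝ) < N := (div_pos (sub_pos.mpr hst) (lt_min hη hb)).trans hN
  have hmul : s + N * ((t - s) / N) = t := by
    rw [mul_div_cancel₀ _ hN₀.ne', add_sub_cancel]
  have hlt : (t - s) / N < min η b := (div_lt_comm₀ (lt_min hη hb) hN₀).mp hN
  have hτ : UniformGrid ((t - s) / N) N fun k => s + k * ((t - s) / N) :=
    uniformGrid_add_mul (div_pos (sub_pos.mpr hst) hN₀) hs (hmul.trans_le ht)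
  refine ⟨N, (t - s) / N, mod_cast hN₀, (hlt.trans_le (min_le_right η b)).le, hmul, hτ, ?_⟩
  intro k hk
  have hstep := hexp _ _ (hτ.nonneg_apply k) (hτ.strictMono k.lt_succ_self) (hτ.apply_le_one hk)
  rw [hτ.succ_sub] at hstep
  exact hstep (hlt.trans_le (min_le_left η b))

theorem norm_remainder_le (hX : R.IsDavieSolution X) (hR : R.IsRegular d α M K L) (hs : 0 ≤ s)
    (hst : s < t) (ht : t ≤ 1) :
    ‖R.remainder s t (X s) (X t)‖ ≤ constC3 d d' α M K L * ((t - s) ^ α) ^ 3 := by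
  have hc := hR.admissible
  refine le_of_forall_pos_le_add fun ε hε => ?_
  obtain ⟨N, h, hN, hh, rfl, hy⟩ := hX.exists_isApproxTrajectory
    (lt_min hε (hc.inv_two_add_locC3_pos d d')) (div_pos (hc.delta_pos d d') three_pos) hs hst ht
  have hbound := hy.norm_remainder_le_add hR (min_le_right _ _) (by linarith) hN le_rfl
  simp only [Nat.cast_zero, zero_mul, add_zero] at hbound
  refine hbound.trans (add_le_add_right ?_ _)
  calc _ ≤ ε * 1 := mul_le_mul (min_le_left _ _) (by linarith) (sub_pos.mpr hst).le hε.le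
    _ = ε := mul_one ε

end IsDavieSolution

namespace IsRegular

theorem norm_increment_le (hR : R.IsRegular d α M K L) {s t : ℝ} (hs : 0 ≤ s) (hst : s < t)
    (ht : t ≤ 1) (x : E) : ‖R.increment s t x‖ ≤ (locC1 d d' M K L - 1) * (t - s) ^ α := by
  have : 0 ≤ M := hR.bound_nonneg
  have hL := hR.area_nonneg
  have hfirst : ‖R.firstRemainder s t x (x + R.increment s t x)‖ ≤
      d * d' ^ 2 * M ^ 2 * L * ((t - s) ^ α) ^ 2 := by
    have harea : R.firstRemainder s t x (x + R.increment s t x) = R.areaTerm (R.area s t) x := by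
      unfold firstRemainder increment noise
      abel
    rw [harea, mul_assoc _ L]
    exact (hR.norm_areaTerm_le _ x).trans
      (mul_le_mul_of_nonneg_left (hR.norm_area_le s t hs hst ht) (by positivity))
  have hsub := hR.norm_sub_le_of_firstRemainder_le hs hst ht (by positivity) hfirst
  rw [add_sub_cancel_left] at hsub
  refine hsub.trans_eq ?_
  unfold locC1
  ring

variable {X : ℝ → E} (hR : R.IsRegular d α M K L) (hX : R.IsDavieSolution X)
include hR hX

theorem norm_trajectory_gridPoint_sub_le {n k : ℕ} (hk : k ≤ 2 ^ n)
    (hh : 3 * mesh n ≤ delta d d' α M K L) (hh' : 3 * mesh n ≤ delta' d d' α M K L) :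
    ‖R.trajectory (gridPoint n) (X 0) k - X (gridPoint n k)‖ ≤
      2 ^ (2 / delta' d d' α M K L) * constC3 d d' α M K L * mesh n ^ (3 * α - 1) := by
  have hτ := uniformGrid_gridPoint hk
  have hC := hR.admissible.constC3_nonneg d d'
  have herror := hR.norm_trajectory_sub_le hτ hh hh' (y := fun j => X (gridPoint n j))
    (η := constC3 d d' α M K L * (mesh n ^ α) ^ 3) fun j hj => by
      simpa only [hτ.succ_sub] using hX.norm_remainder_le hR (hτ.nonneg_apply j)
        (hτ.strictMono j.lt_succ_self) (hτ.apply_le_one hj)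
  simp only [gridPoint, Nat.cast_zero, zero_div] at herror
  have hmesh := Real.rpow_nonneg (mesh_pos n).le α
  have hcast : (k : ℝ) ≤ 2 ^ n := mod_cast hk
  calc _ ≤ k * (2 ^ (2 / delta' d d' α M K L) * (constC3 d d' α M K L * (mesh n ^ α) ^ 3)) :=
        herror
    _ ≤ 2 ^ n * (2 ^ (2 / delta' d d' α M K L) * (constC3 d d' α M K L * (mesh n ^ α) ^ 3)) := by
        gcongr
    _ = _ := by
        rw [← two_pow_mul_mesh_rpow_cube]
        ring

theorem norm_solution_sub_le {s t : ℝ} (hs : 0 ≤ s) (hst : s ≤ t) (ht : t ≤ 1) :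
    ‖X t - X s‖ ≤ (locC1 d d' M K L - 1) * (t - s) ^ α
      + constC3 d d' α M K L * ((t - s) ^ α) ^ 3 := by
  rcases hst.eq_or_lt with rfl | hst
  · simp [Real.zero_rpow hR.exponent_pos.ne']
  · rw [← add_sub_cancel (R.increment s t (X s)) (X t - X s)]
    exact norm_add_le_of_le (hR.norm_increment_le hs hst ht _) (hX.norm_remainder_le hR hs hst ht)

end IsRegular

end RoughEquation

namespace AdmissibleConstants

variable (hc : AdmissibleConstants α M K L) (d d')
include hc

theorem one_le_two_div_ratio : (1 : ℝ) ≤ 2 / (1 - 2 ^ (1 - 3 * α)) :=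
  (one_le_div hc.ratio_pos).mpr (by linarith [Real.rpow_pos_of_pos two_pos (1 - 3 * α)])

theorem one_le_constC1 : 1 ≤ constC1 d d' α M K L := by
  have hδ : 1 ≤ 2 / delta d d' α M K L :=
    (one_le_div (hc.delta_pos d d')).mpr (by linarith [hc.delta_le_half d d'])
  have hloc : 1 ≤ locC1 d d' M K L := by
    obtain ⟨-, hM, hK, hL⟩ := hc
    rw [locC1, add_assoc, add_assoc]
    exact le_add_of_nonneg_right (by positivity)
  exact one_le_mul_of_one_le_of_one_le hδ hloc

variable {d}

theorem locC1_sub_one_le_kappa (hd : d ≠ 0) {c₁ c₂ : ℝ} (h₁ : 1 ≤ c₁) (h₂ : 0 ≤ c₂) :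
    locC1 d d' M K L - 1 ≤ kappa d d' M K L c₁ c₂ := by
  obtain ⟨-, hM, hK, hL⟩ := hc
  have hd₁ : (1 : ℝ) ≤ d := Nat.one_le_cast.mpr (Nat.one_le_iff_ne_zero.mpr hd)
  have hdc : 1 ≤ d * c₁ := one_le_mul_of_one_le_of_one_le hd₁ h₁
  calc locC1 d d' M K L - 1
      = M * 1 + d' * K * (M * 1) + d * d' ^ 2 * M ^ 2 * L * 1 := by
        unfold locC1
        ring
    _ ≤ M * (d * c₁) + d' * K * (M * (d * c₁) ^ 2 + d * M * (c₂ + M))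
        + d * d' ^ 2 * M ^ 2 * L * (2 * (d * c₁)) := by
        have hsq : M * 1 ≤ M * (d * c₁) ^ 2 + d * M * (c₂ + M) :=
          (mul_le_mul_of_nonneg_left (one_le_pow₀ hdc) hM).trans
            (le_add_of_nonneg_right (by positivity))
        gcongr
        linarith
    _ = kappa d d' M K L c₁ c₂ := by
        unfold kappa
        ring

theorem locC1_sub_one_le_constC3 (hd : d ≠ 0) : locC1 d d' M K L - 1 ≤ constC3 d d' α M K L :=
  (hc.locC1_sub_one_le_kappa d' hd (hc.one_le_constC1 d d') (hc.constC2_pos d d').le).trans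
    (le_mul_of_one_le_left (hc.kappa_const_nonneg d d') hc.one_le_two_div_ratio)

end AdmissibleConstants

theorem mesh_rpow_le (n : ℕ) (hα : α ≤ 1 / 2) : mesh n ^ α ≤ mesh n ^ (3 * α - 1) :=
  Real.rpow_le_rpow_of_exponent_ge (mesh_pos n) (mesh_le_one n) (by linarith)

theorem mesh_rpow_cube_le (n : ℕ) (α : ℝ) : (mesh n ^ α) ^ 3 ≤ mesh n ^ (3 * α - 1) := by
  have hmesh := Real.rpow_nonneg (mesh_pos n).le α
  rw [← two_pow_mul_mesh_rpow_cube]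
  exact le_mul_of_one_le_left (by positivity) (one_le_pow₀ one_le_two)

namespace RoughEquation.IsRegular

variable {R : RoughEquation E d'} {X : ℝ → E} (hR : R.IsRegular d α M K L)
  (hX : R.IsDavieSolution X) (hd : d ≠ 0)
include hR hX hd

theorem norm_solution_gridPoint_floor_sub_le (n : ℕ) {t : ℝ} (ht : t ∈ Set.Icc (0 : ℝ) 1) :
    ‖X (gridPoint n ⌊2 ^ n * t⌋₊) - X t‖ ≤
      2 * constC3 d d' α M K L * mesh n ^ (3 * α - 1) := by
  have hfloor := gridPoint_floor_le ht.1 n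
  have : 0 ≤ (t - gridPoint n ⌊2 ^ n * t⌋₊) ^ α := Real.rpow_nonneg (sub_nonneg.mpr hfloor) α
  have hω : (t - gridPoint n ⌊2 ^ n * t⌋₊) ^ α ≤ mesh n ^ α :=
    Real.rpow_le_rpow (sub_nonneg.mpr hfloor) (sub_gridPoint_floor_le n t) hR.exponent_pos.le
  have hC := hR.admissible.constC3_nonneg d d'
  rw [norm_sub_rev]
  calc _ ≤ (locC1 d d' M K L - 1) * (t - gridPoint n ⌊2 ^ n * t⌋₊) ^ α
        + constC3 d d' α M K L * ((t - gridPoint n ⌊2 ^ n * t⌋₊) ^ α) ^ 3 :=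
        hR.norm_solution_sub_le hX (gridPoint_nonneg n _) hfloor ht.2
    _ ≤ constC3 d d' α M K L * mesh n ^ α + constC3 d d' α M K L * (mesh n ^ α) ^ 3 := by
        gcongr
        exact hR.admissible.locC1_sub_one_le_constC3 d' hd
    _ ≤ constC3 d d' α M K L * mesh n ^ (3 * α - 1)
        + constC3 d d' α M K L * mesh n ^ (3 * α - 1) :=
        add_le_add (mul_le_mul_of_nonneg_left (mesh_rpow_le n hR.exponent_mem.2) hC)
          (mul_le_mul_of_nonneg_left (mesh_rpow_cube_le n α) hC)
    _ = _ := by ring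

theorem norm_trajectory_floor_sub_le {n : ℕ} (hh : 3 * mesh n ≤ delta d d' α M K L)
    (hh' : 3 * mesh n ≤ delta' d d' α M K L) {t : ℝ} (ht : t ∈ Set.Icc (0 : ℝ) 1) :
    ‖R.trajectory (gridPoint n) (X 0) ⌊2 ^ n * t⌋₊ - X t‖ ≤
      constG1 d d' α M K L * mesh n ^ (3 * α - 1) := by
  have hc := hR.admissible
  have hC := hc.constC3_nonneg d d'
  have hmesh := Real.rpow_nonneg (mesh_pos n).le (3 * α - 1)
  calc _ ≤ 2 ^ (2 / delta' d d' α M K L) * constC3 d d' α M K L * mesh n ^ (3 * α - 1)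
        + 2 * constC3 d d' α M K L * mesh n ^ (3 * α - 1) :=
        norm_sub_le_norm_sub_add_norm_sub _ (X (gridPoint n ⌊2 ^ n * t⌋₊)) _ |>.trans <| add_le_add
          (hR.norm_trajectory_gridPoint_sub_le hX (floor_two_pow_mul_le ht.2 n) hh hh')
          (hR.norm_solution_gridPoint_floor_sub_le hX hd n ht)
    _ = (2 + 2 ^ (2 / delta' d d' α M K L)) * constC3 d d' α M K L * mesh n ^ (3 * α - 1) := by
        ring
    _ ≤ constG1 d d' α M K L * mesh n ^ (3 * α - 1) :=
        mul_le_mul_of_nonneg_right (mul_le_mul_of_nonneg_right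
          ((hc.constB_ge d d').trans (le_add_of_nonneg_left zero_le_one)) hC) hmesh

end RoughEquation.IsRegular

section Coordinates

theorem norm_le_pow_mul_of_norm_apply_single_le {F : Type*} [NormedAddCommGroup F]
    [NormedSpace ℝ F] {k : ℕ} (T : ContinuousMultilinearMap ℝ (fun _ : Fin k => Fin d → ℝ) F)
    {C : ℝ} (hC : 0 ≤ C) (hT : ∀ l : Fin k → Fin d, ‖T fun a => Pi.single (l a) 1‖ ≤ C) :
    ‖T‖ ≤ d ^ k * C := by
  refine T.opNorm_le_bound (by positivity) fun v => ?_
  have hexpand : T v = ∑ l : Fin k → Fin d, (∏ a, v a (l a)) • T fun a => Pi.single (l a) 1 := by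
    conv_lhs => rw [show v = fun a => ∑ i, v a i • Pi.single i 1 from
      funext fun a => pi_eq_sum_univ' (v a)]
    rw [T.map_sum]
    exact Finset.sum_congr rfl fun l _ => T.map_smul_univ _ _
  have hterm (l : Fin k → Fin d) :
      ‖(∏ a, v a (l a)) • T fun a => Pi.single (l a) 1‖ ≤ (∏ a, ‖v a‖) * C := by
    rw [norm_smul, norm_prod]
    have hcoord : ∏ a, ‖v a (l a)‖ ≤ ∏ a, ‖v a‖ :=
      Finset.prod_le_prod (fun a _ => norm_nonneg _) fun a _ => norm_le_pi_norm (v a) (l a)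
    exact mul_le_mul hcoord (hT l) (norm_nonneg _) (by positivity)
  rw [hexpand, mul_assoc, mul_comm C]
  exact (norm_sum_le_of_le _ fun l _ => hterm l).trans_eq (by simp)

theorem BoundedDerivs.of_apply_single {F : Type} [NormedAddCommGroup F] [NormedSpace ℝ F]
    {n : ℕ} {f : (Fin d → ℝ) → F} (hM : 0 ≤ M)
    (hdiff : ∀ k < n, Differentiable ℝ (iteratedFDeriv ℝ k f))
    (hf : ∀ k ≤ n, ∀ x, ∀ l : Fin k → Fin d,
      ‖iteratedFDeriv ℝ k f x fun a => Pi.single (l a) 1‖ ≤ M) : BoundedDerivs d M n f where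
  differentiable_iteratedFDeriv := hdiff
  norm_iteratedFDeriv_le k hk x := norm_le_pow_mul_of_norm_apply_single_le _ hM (hf k hk x)

variable {μ : (Fin d → ℝ) → Fin d → ℝ} {σ : (Fin d → ℝ) → Fin d → Fin d' → ℝ}
  {Z : ℝ → Fin d' → ℝ} {A : ℝ → ℝ → Fin d' → Fin d' → ℝ}

theorem norm_path_sub_le_of_pathNorm_le (hK : 0 ≤ K) (hZ : pathNorm α Z ≤ ENNReal.ofReal K)
    {s t : ℝ} (hs : 0 ≤ s) (hst : s < t) (ht : t ≤ 1) : ‖Z t - Z s‖ ≤ K * (t - s) ^ α := by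
  simp only [pathNorm, iSup_le_iff] at hZ
  exact (div_le_iff₀ (Real.rpow_pos_of_pos (sub_pos.mpr hst) α)).mp
    ((ENNReal.ofReal_le_ofReal_iff hK).mp (hZ s t hs hst ht))

theorem norm_area_le_of_areaNorm_le (hL : 0 ≤ L) (hA : areaNorm α A ≤ ENNReal.ofReal L)
    {s t : ℝ} (hs : 0 ≤ s) (hst : s < t) (ht : t ≤ 1) : ‖A s t‖ ≤ L * ((t - s) ^ α) ^ 2 := by
  simp only [areaNorm, iSup_le_iff] at hA
  have : 0 ≤ (t - s) ^ α := Real.rpow_nonneg (sub_pos.mpr hst).le α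
  refine (pi_norm_le_iff_of_nonneg (by positivity)).mpr fun i =>
    (pi_norm_le_iff_of_nonneg (by positivity)).mpr fun j => ?_
  have hij := (div_le_iff₀ (Real.rpow_pos_of_pos (sub_pos.mpr hst) _)).mp
    ((ENNReal.ofReal_le_ofReal_iff hL).mp (hA s t hs hst ht i j))
  rwa [mul_comm 2 α, Real.rpow_mul (sub_pos.mpr hst).le, Real.rpow_two] at hij

theorem CoeffBounds.boundedDerivs_drift (h : CoeffBounds μ σ M) (hM : 0 ≤ M) :
    BoundedDerivs d M 1 μ := by
  refine .of_apply_single hM (fun k hk => ?_) fun k hk x l =>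
    (pi_norm_le_iff_of_nonneg hM).mpr fun i => ?_
  · obtain rfl := Nat.lt_one_iff.mp hk
    exact differentiable_iteratedFDeriv_zero_iff.mpr h.differentiable_drift
  · rcases Nat.le_one_iff_eq_zero_or_eq_one.mp hk with rfl | rfl
    · simpa only [iteratedFDeriv_zero_apply, Real.norm_eq_abs] using h.drift_le x i
    · simpa only [iteratedFDeriv_one_apply, Real.norm_eq_abs] using h.fderiv_drift_le x (l 0) i

/-- The `j`-th column of a matrix, as a continuous linear map. -/
def columnCLM (j : Fin d') : (Fin d → Fin d' → ℝ) →L[ℝ] Fin d → ℝ :=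
  .pi fun i => (ContinuousLinearMap.proj (R := ℝ) (φ := fun _ : Fin d' => ℝ) j).comp
    (ContinuousLinearMap.proj (R := ℝ) (φ := fun _ : Fin d => Fin d' → ℝ) i)

theorem CoeffBounds.boundedDerivs_diffusion (h : CoeffBounds μ σ M) (hM : 0 ≤ M) (j : Fin d') :
    BoundedDerivs d M 3 fun x i => σ x i j := by
  have hσ : BoundedDerivs d M 3 σ := .of_apply_single hM h.differentiable_diffusion
    fun k hk x l => (pi_norm_le_iff_of_nonneg hM).mpr fun i =>
      (pi_norm_le_iff_of_nonneg hM).mpr fun j => h.diffusion_le k hk x l i j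
  refine hσ.clm_comp (columnCLM j) ((columnCLM j).opNorm_le_bound zero_le_one fun v => ?_)
  rw [one_mul]
  exact (pi_norm_le_iff_of_nonneg (norm_nonneg v)).mpr fun i =>
    (norm_le_pi_norm (v i) j).trans (norm_le_pi_norm v i)

namespace RoughEquation

/-- The equation in `ℝ^d` given by coefficients and a driving path in coordinates. -/
def ofCoordinates (μ : (Fin d → ℝ) → Fin d → ℝ) (σ : (Fin d → ℝ) → Fin d → Fin d' → ℝ)
    (Z : ℝ → Fin d' → ℝ) (A : ℝ → ℝ → Fin d' → Fin d' → ℝ) : RoughEquation (Fin d → ℝ) d' where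
  drift := μ
  diffusion j x i := σ x i j
  path := Z
  area := A

theorem isRegular_ofCoordinates (hc : AdmissibleConstants α M K L) (h : CoeffBounds μ σ M)
    (hZA : IsArea Z A) (hZ : pathNorm α Z ≤ ENNReal.ofReal K)
    (hA : areaNorm α A ≤ ENNReal.ofReal L) : (ofCoordinates μ σ Z A).IsRegular d α M K L where
  exponent_mem := hc.exponent_mem
  drift := h.boundedDerivs_drift hc.bound_nonneg
  diffusion := h.boundedDerivs_diffusion hc.bound_nonneg
  isArea := hZA
  norm_path_sub_le _ _ := norm_path_sub_le_of_pathNorm_le hc.path_nonneg hZ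
  norm_area_le _ _ := norm_area_le_of_areaNorm_le hc.area_nonneg hA

theorem fderiv_column_apply (hσ : Differentiable ℝ σ) (j : Fin d') (x v : Fin d → ℝ) (i : Fin d) :
    fderiv ℝ (fun x i => σ x i j) x v i = ∑ l, v l * partialDeriv σ l i j x := by
  have hcolumn : HasFDerivAt (fun x i => σ x i j) ((columnCLM j).comp (fderiv ℝ σ x)) x :=
    (columnCLM j).hasFDerivAt.comp x hσ.differentiableAt.hasFDerivAt
  have hexpand : fderiv ℝ σ x v = ∑ l, v l • fderiv ℝ σ x (Pi.single l 1) := by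
    conv_lhs => rw [pi_eq_sum_univ' v, map_sum]
    exact Finset.sum_congr rfl fun l _ => map_smul _ _ _
  rw [hcolumn.fderiv]
  change fderiv ℝ σ x v i j = _
  rw [hexpand]
  simp only [Finset.sum_apply, Pi.smul_apply, smul_eq_mul, partialDeriv]

theorem increment_ofCoordinates (hσ : Differentiable ℝ σ) (s t : ℝ) (x : Fin d → ℝ) :
    (ofCoordinates μ σ Z A).increment s t x = RoughMilstein.increment μ σ Z A s t x := by
  have hfderiv (i : Fin d) (j m : Fin d') :
      fderiv ℝ ((ofCoordinates μ σ Z A).diffusion j) x ((ofCoordinates μ σ Z A).diffusion m x) i =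
        ∑ l, σ x l m * partialDeriv σ l i j x := fderiv_column_apply hσ j x _ i
  funext i
  simp only [increment, linearTerm, noise, areaTerm, RoughMilstein.increment, Pi.add_apply,
    Pi.smul_apply, Finset.sum_apply, smul_eq_mul, hfderiv, Finset.mul_sum, ← add_assoc]
  congr 1
  · simp only [ofCoordinates, Pi.sub_apply, mul_comm]
  · refine Finset.sum_congr rfl fun j _ => Finset.sum_comm.trans ?_
    exact Finset.sum_congr rfl fun l _ => Finset.sum_congr rfl fun m _ => by
      rw [mul_comm, mul_comm (σ x l m)]; rfl

theorem trajectory_ofCoordinates (hσ : Differentiable ℝ σ) (x : Fin d → ℝ) (n k : ℕ) :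
    (ofCoordinates μ σ Z A).trajectory (gridPoint n) x k = schemeGrid μ σ Z A x n k := by
  induction k with
  | zero => rfl
  | succ k ih => rw [trajectory, schemeGrid, ih, increment_ofCoordinates hσ]

theorem isDavieSolution_ofCoordinates (hσ : Differentiable ℝ σ) {x₀ : Fin d → ℝ}
    {X : ℝ → Fin d → ℝ} (hX : IsSolution μ σ Z A x₀ X) :
    (ofCoordinates μ σ Z A).IsDavieSolution X := fun ε hε => by
  obtain ⟨η, hη, hexp⟩ := hX.expansion ε hε
  refine ⟨η, hη, fun s t hs hst ht hlt => ?_⟩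
  rw [remainder, increment_ofCoordinates hσ]
  exact (pi_norm_le_iff_of_nonneg (mul_nonneg hε.le (sub_pos.mpr hst).le)).mpr
    (hexp s t hs hst ht hlt)

end RoughEquation
end Coordinates

end RoughMilstein

open RoughMilstein in
theorem mainTheorem3_general {d : ℕ} (hd : d ≠ 0) (d' : ℕ) {α M K L : ℝ}
    (hc : AdmissibleConstants α M K L) :
    ∃ n₀ : ℕ, ∀ (E : Type*) [NormedAddCommGroup E] [NormedSpace ℝ E] (R : RoughEquation E d'),
      R.IsRegular d α M K L → ∀ X : ℝ → E, R.IsDavieSolution X →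
      ∀ n ≥ n₀, ∀ t ∈ Set.Icc (0 : ℝ) 1,
        ‖R.trajectory (gridPoint n) (X 0) ⌊2 ^ n * t⌋₊ - X t‖ ≤
          constG1 d d' α M K L * mesh n ^ (3 * α - 1) := by
  obtain ⟨n₀, hn₀⟩ := Filter.eventually_atTop.mp ((eventually_mul_mesh_le 3 (hc.delta_pos d d')).and
    (eventually_mul_mesh_le 3 (hc.delta'_pos d d')))
  exact ⟨n₀, fun E _ _ R hR X hX n hn t ht =>
    hR.norm_trajectory_floor_sub_le hX hd (hn₀ n hn).1 (hn₀ n hn).2 ht⟩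

open RoughMilstein in
theorem mainTheorem3 (d d' : ℕ) (α : ℝ) (hα : α ∈ Set.Ioo (1 / 3 : ℝ) (1 / 2))
    (M K L : ℝ) (hM : 0 ≤ M) (hK : 0 ≤ K) (hL : 0 ≤ L) :
    ∃ n₀ : ℕ, ∀ (μ : (Fin d → ℝ) → Fin d → ℝ) (σ : (Fin d → ℝ) → Fin d → Fin d' → ℝ),
      CoeffBounds μ σ M →
      ∀ (Z : ℝ → Fin d' → ℝ) (A : ℝ → ℝ → Fin d' → Fin d' → ℝ),
      pathNorm α Z ≤ ENNReal.ofReal K → areaNorm α A ≤ ENNReal.ofReal L →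
      ∀ (x₀ : Fin d → ℝ) (X : ℝ → Fin d → ℝ), IsSolution μ σ Z A x₀ X →
      ∀ n ≥ n₀, ∀ t ∈ Set.Icc (0 : ℝ) 1,
        ‖scheme μ σ Z A x₀ n t - X t‖ ≤ constG1 d d' α M K L * mesh n ^ (3 * α - 1) := by
  have hc : AdmissibleConstants α M K L := ⟨Set.Ioo_subset_Ioc_self hα, hM, hK, hL⟩
  rcases eq_or_ne d 0 with rfl | hd
  · exact ⟨0, fun μ σ _ Z A _ _ x₀ X _ n _ t _ => by
      rw [Subsingleton.elim (scheme μ σ Z A x₀ n t - X t) 0, norm_zero]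
      exact mul_nonneg (hc.constG1_nonneg 0 d') (Real.rpow_nonneg (mesh_pos n).le _)⟩
  obtain ⟨n₀, hn₀⟩ := mainTheorem3_general hd d' hc
  refine ⟨n₀, fun μ σ hμσ Z A hZ hA x₀ X hX n hn t ht => ?_⟩
  have hR := RoughEquation.isRegular_ofCoordinates hc hμσ hX.area hZ hA
  have hσ : Differentiable ℝ σ :=
    differentiable_iteratedFDeriv_zero_iff.mp (hμσ.differentiable_diffusion 0 three_pos)
  rw [scheme, ← RoughEquation.trajectory_ofCoordinates hσ, ← hX.initial]
  exact hn₀ _ _ hR X (RoughEquation.isDavieSolution_ofCoordinates hσ hX) n hn t ht
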